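/- Let $E, E'$ denote real Banach spaces of dimension at least two. A proper domain $G\subsetneq E$ is a nonempty connected open set, $\partial G$ is its boundary, and $d_G(x)=\operatorname{dist}(x,\partial G)$ for $x\in G$, where the distance is to the norm boundary in $E$. For $x,y\in G$ put $$r_G(x,y)=\frac{|x-y|}{\min\{d_G(x),d_G(y)\}},\qquad k_G(x,y)=\inf_\alpha\int_\alpha\frac{|dz|}{d_G(z)},$$ the infimum being over all rectifiable curves $\alpha$ in $G$ joining $x$ and $y$; for $\emptyset\ne A\subseteq G$ put $r_G(A)=\sup_{x,y\in A}r_G(x,y)$ and $k_G(A)=\sup_{x,y\in A}k_G(x,y)$. * For an increasing (i.e. nondecreasing) function $\psi:[0,\infty)\to[0,\infty)$, $G$ is *$\psi$-natural* if $k_G(A)\le\psi(r_G(A))$ for every nonempty connected $A\subseteq G$ with $r_G(A)<\infty$. * For $c\ge1$, $G$ is *$c$-uniform* if any two distinct points $x,y\in G$ can be joined by an arc $\gamma$ in $G$ with $\ell(\gamma)\le c|x-y|$ and $\min\{\ell(\gamma[x,z]),\ell(\gamma[z,y])\}\le c\,d_G(z)$ for all $z\in\gamma$, where $\ell$ is length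 and $\gamma[u,v]$ is the part of $\gamma$ between $u$ and $v$. * For $M\ge1$, $C\ge0$, a homeomorphism $f:G\to G'$ is *$(M,C)$-CQH* if $\frac{k_G(x,y)-C}{M}\le k_{G'}(f(x),f(y))\le M k_G(x,y)+C$ for all $x,y\in G$. * Let $\dot E=E\cup\{\infty\}$, where the neighbourhoods of $\infty$ are the complements of closed bounded sets of $E$. The cross ratio of four distinct points of $\dot E$ is $\tau(x,y,z,w)=\frac{|x-z|}{|x-y|}\cdot\frac{|y-w|}{|z-w|}$, the two factors containing $\infty$ being omitted if one of the points is $\infty$. For a homeomorphism $\eta:[0,\infty)\to[0,\infty)$, a homeomorphism $F:X\to X'$ between sets $X\subseteq\dot E$, $X'\subseteq\dot E'$ is *$\eta$-quasimöbius relative to $A\subseteq X$* if $\tau(F(x),F(y),F(z),F(w))\le\eta(\tau(x,y,z,w))$ for all distinct $x,y,z,w\in X$ with $\{x,w\}\subseteq A$ or $\{y,z\}\subseteq A$. **Theorem.** Let $G\subsetneq E$ and $G'\subsetneq E'$ be proper domains in real Banach spaces of dimension at least two. Suppose that $f:G\to G'$ is $(M,C)$-CQH and that $f$ extends to a homeomorphism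 $\overline G\to\overline{G'}$ which is $\eta$-quasimöbius relative to $\partial G$; here the closures and the boundary are either all taken in the norm topologies of $E,E'$, or all taken in $\dot E,\dot E'$ (the result holds in each of the two cases). 1. If $G$ is $\psi$-natural, then $G'$ is $\psi'$-natural with an increasing $\psi':[0,\infty)\to[0,\infty)$ depending only on $\psi,M,C,\eta$. 2. If $G$ is $c$-uniform, then $G'$ is $c'$-uniform with $c'\ge1$ depending only on $c,M,C,\eta$. -/

import Mathlib

open scoped NNReal ENNReal

universe u v

namespace RelQM

/-! ### Domains, boundary distance, quasihyperbolic distance -/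

section Domains

variable {E : Type u} [NormedAddCommGroup E] [NormedSpace ℝ E]

/-- A proper domain: a nonempty connected open set different from the whole space. -/
structure IsProperDomain (G : Set E) : Prop where
  isOpen : IsOpen G
  isConnected : IsConnected G
  ne_univ : G ≠ Set.univ

/-- `d_G(x) = dist(x, ∂G)`, with `∂G` the norm boundary. -/
noncomputable def bdist (G : Set E) (x : E) : ℝ := Metric.infDist x (frontier G)

/-- `γ`, restricted to `[0,1]`, is a rectifiable curve in `G` from `x` to `y`. -/
structure IsRectCurve (G : Set E) (x y : E) (γ : ℝ → E) : Prop where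
  continuousOn : ContinuousOn γ (Set.Icc 0 1)
  mapsTo : Set.MapsTo γ (Set.Icc 0 1) G
  source : γ 0 = x
  target : γ 1 = y
  rectifiable : eVariationOn γ (Set.Icc 0 1) ≠ ∞

/-- The quasihyperbolic length `∫_γ |dz| / d_G(z)` of a rectifiable curve `γ : [0,1] → E`,
computed in the arclength parametrization of `γ` on `[0, ℓ(γ)]`. -/
noncomputable def qhLength (G : Set E) (γ : ℝ → E) : ℝ≥0∞ :=
  ∫⁻ t in Set.Icc 0 (eVariationOn γ (Set.Icc 0 1)).toReal,
    ENNReal.ofReal (1 / bdist G (naturalParameterization γ (Set.Icc 0 1) 0 t))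

/-- The quasihyperbolic distance `k_G(x,y)` with values in `[0,∞]`
(it is finite for points of a proper domain). -/
noncomputable def qhEDist (G : Set E) (x y : E) : ℝ≥0∞ :=
  ⨅ (γ : ℝ → E) (_ : IsRectCurve G x y γ), qhLength G γ

/-- The quasihyperbolic distance `k_G(x,y)` as a real number. -/
noncomputable def qhDist (G : Set E) (x y : E) : ℝ := (qhEDist G x y).toReal

/-- The relative distance `r_G(x,y) = |x - y| / min (d_G(x), d_G(y))`. -/
noncomputable def relDist (G : Set E) (x y : E) : ℝ :=
  dist x y / min (bdist G x) (bdist G y)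

/-- `r_G(A)`, the supremum of `r_G` over pairs of points of `A`, in `[0,∞]`. -/
noncomputable def relDiam (G A : Set E) : ℝ≥0∞ :=
  ⨆ (x ∈ A) (y ∈ A), ENNReal.ofReal (relDist G x y)

/-- `k_G(A)`, the supremum of `k_G` over pairs of points of `A`, in `[0,∞]`. -/
noncomputable def qhDiam (G A : Set E) : ℝ≥0∞ :=
  ⨆ (x ∈ A) (y ∈ A), qhEDist G x y

/-- `G` is `ψ`-natural. -/
def IsNatural (ψ : ℝ≥0 → ℝ≥0) (G : Set E) : Prop :=
  ∀ A : Set E, A ⊆ G → IsConnected A → relDiam G A ≠ ∞ →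
    qhDiam G A ≤ (ψ (relDiam G A).toNNReal : ℝ≥0∞)

/-- `G` is `c`-uniform: any two distinct points of `G` are joined by an arc (an injective curve
`γ : [0,1] → G`) such that `ℓ(γ) ≤ c |x - y|` and
`min (ℓ(γ[x,z]), ℓ(γ[z,y])) ≤ c d_G(z)` for all `z = γ t` on the arc. -/
def IsUniform (c : ℝ) (G : Set E) : Prop :=
  ∀ x ∈ G, ∀ y ∈ G, x ≠ y → ∃ γ : ℝ → E,
    ContinuousOn γ (Set.Icc 0 1) ∧ Set.InjOn γ (Set.Icc 0 1) ∧
    Set.MapsTo γ (Set.Icc 0 1) G ∧ γ 0 = x ∧ γ 1 = y ∧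
    eVariationOn γ (Set.Icc 0 1) ≤ ENNReal.ofReal (c * dist x y) ∧
    ∀ t ∈ Set.Icc (0 : ℝ) 1,
      min (eVariationOn γ (Set.Icc 0 t)) (eVariationOn γ (Set.Icc t 1)) ≤
        ENNReal.ofReal (c * bdist G (γ t))

end Domains

/-! ### The one-point extension `Ė = E ∪ {∞}` -/

/-- The one-point extension of `E`. It is not `OnePoint E`: here the neighbourhoods
of `∞` are the complements of closed *bounded* sets. -/
inductive Ext (E : Type u) : Type u
  | infty : Ext E
  | fin : E → Ext E

namespace Ext

variable {E : Type u} [NormedAddCommGroup E]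

instance : TopologicalSpace (Ext E) where
  IsOpen s := IsOpen (fin ⁻¹' s) ∧ (infty ∈ s → Bornology.IsBounded (fin ⁻¹' s)ᶜ)
  isOpen_univ := by simp
  isOpen_inter s t hs ht := by
    refine ⟨hs.1.inter ht.1, fun h => ?_⟩
    rw [Set.preimage_inter, Set.compl_inter]
    exact (hs.2 h.1).union (ht.2 h.2)
  isOpen_sUnion S hS := by
    refine ⟨?_, ?_⟩
    · rw [Set.preimage_sUnion]
      exact isOpen_biUnion fun s hs => (hS s hs).1
    · rintro ⟨s, hs, h⟩
      refine ((hS s hs).2 h).subset ?_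
      exact Set.compl_subset_compl.2 (Set.preimage_mono (Set.subset_sUnion_of_mem hs))

/-- The distance of two points of `E`, and `1` if one of the points is `∞`: in a cross ratio
of four distinct points this has the effect of omitting the two factors that contain `∞`. -/
noncomputable def gap : Ext E → Ext E → ℝ≥0
  | fin x, fin y => nndist x y
  | _, _ => 1

/-- The cross ratio `τ(x,y,z,w) = (|x - z| / |x - y|) * (|y - w| / |z - w|)` in `Ė`. -/
noncomputable def crossRatio (x y z w : Ext E) : ℝ≥0 :=
  (gap x z / gap x y) * (gap y w / gap z w)

/-- The norm closure of `G ⊆ E`, as a subset of `Ė`. -/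
def normClosure (G : Set E) : Set (Ext E) := fin '' closure G

/-- The norm boundary of `G ⊆ E`, as a subset of `Ė`. -/
def normBoundary (G : Set E) : Set (Ext E) := fin '' frontier G

/-- The closure of `G ⊆ E` in `Ė` (it contains `∞` if and only if `G` is unbounded). -/
def extClosure (G : Set E) : Set (Ext E) := closure (fin '' G)

/-- The boundary of `G ⊆ E` in `Ė`. -/
def extBoundary (G : Set E) : Set (Ext E) := frontier (fin '' G)

end Ext

/-! ### Mappings -/

section Maps

variable {E : Type u} [NormedAddCommGroup E] [NormedSpace ℝ E]
  {E' : Type v} [NormedAddCommGroup E'] [NormedSpace ℝ E']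

/-- The homeomorphism `f : G → G'` is `(M,C)`-CQH (`C`-coarsely `M`-quasihyperbolic). -/
def IsCQH (M C : ℝ) {G : Set E} {G' : Set E'} (f : G ≃ₜ G') : Prop :=
  ∀ x y : G, (qhDist G x y - C) / M ≤ qhDist G' (f x) (f y) ∧
    qhDist G' (f x) (f y) ≤ M * qhDist G x y + C

/-- A homeomorphism `F : X → X'` between subsets of `Ė` and `Ė'` is `η`-quasimöbius relative
to `A`: `τ(F(Q)) ≤ η(τ(Q))` for every quadruple `Q = (x,y,z,w)` of distinct points of `X` such that
`{x,w} ⊆ A` or `{y,z} ⊆ A`. -/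
def IsQMRel (η : ℝ≥0 ≃ₜ ℝ≥0) {X : Set (Ext E)} {X' : Set (Ext E')} (F : X ≃ₜ X')
    (A : Set (Ext E)) : Prop :=
  ∀ x y z w : X, x ≠ y → x ≠ z → x ≠ w → y ≠ z → y ≠ w → z ≠ w →
    (((x : Ext E) ∈ A ∧ (w : Ext E) ∈ A) ∨ ((y : Ext E) ∈ A ∧ (z : Ext E) ∈ A)) →
    Ext.crossRatio (F x : Ext E') (F y) (F z) (F w) ≤ η (Ext.crossRatio (x : Ext E) y z w)

/-- `f : G → G'` extends to a homeomorphism `X → X'` that is `η`-quasimöbius relative to `A`. -/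
def ExtendsQMRel (η : ℝ≥0 ≃ₜ ℝ≥0) {G : Set E} {G' : Set E'} (f : G ≃ₜ G')
    (X : Set (Ext E)) (X' : Set (Ext E')) (A : Set (Ext E)) : Prop :=
  ∃ F : X ≃ₜ X',
    (∀ (x : G) (p : X), (p : Ext E) = Ext.fin (x : E) → (F p : Ext E') = Ext.fin (f x : E')) ∧
    IsQMRel η F A

/-- `f : G → G'` extends to a homeomorphism of the closures that is `η`-quasimöbius relative to
the boundary of `G`, where closures and boundary are either all taken in the norm topology of the
Banach spaces or all taken in their one-point extensions. -/
def HasQMExtension (η : ℝ≥0 ≃ₜ ℝ≥0) {G : Set E} {G' : Set E'} (f : G ≃ₜ G') : Prop :=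
  ExtendsQMRel η f (Ext.normClosure G) (Ext.normClosure G') (Ext.normBoundary G) ∨
  ExtendsQMRel η f (Ext.extClosure G) (Ext.extClosure G') (Ext.extBoundary G)

end Maps

end RelQM

/-! Everything rests on comparing r_G(y,z) with r_{G'}(f y,f z). If the latter is at most t, every
boundary point of G' sees f y and f z at comparable distances, so the cross ratios of f y, f z with
two boundary points are bounded, and the relative quasimöbius condition bounds those of y, z. If
r_G(y,z) is large all the same, the whole of ∂G lies near one of the points, say y, on a scale much
smaller than |y - z| (`boundary_near_of_relDist_large`). Now move f z close to a boundary point b of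
G' at bounded quasihyperbolic cost. By the CQH condition the preimage w stays far from ∂G, so the
cross ratios of z, w with boundary points are at most 4. Those of the images are then bounded, and
since f w is very close to b, all of ∂G' must be close to b (`frontier_near_of_boundary_near`). This
is the dichotomy `exists_relDist_le_or_frontier_near`: either r_G(y,z) is bounded, or ∂G' looks like
a single point from one of the images. In the second case a two-segment path around that point,
available in dimension at least two, bounds k_{G'} directly (`qhEDist_le_of_frontier_subset`).

For naturality the dichotomy is applied to the pairs of points of a connected set: either its
preimage has bounded r_G and the naturality of G applies, or the direct bound holds.

For uniformity two properties of G' suffice: k_{G'} is bounded where r_{G'} is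
(`exists_qhEDist_bound`), and G' has points far from the boundary near each of its points, at every
scale up to the distance to another point (`exists_isPlump`). The latter is carried over from G by
cross ratios. Such points at doubling scales, joined by curves that are quasihyperbolically short,
form a cigar curve (`exists_cigar_curve`), and a shortest curve in its trace is an arc with the same
estimates (`IsCurve.exists_arc`). -/

namespace RelQM

open Set Metric Filter Topology

/-! ### Proper domains and the distance to the boundary -/

section Domain

variable {E : Type u} [NormedAddCommGroup E] {G : Set E}

theorem bdist_le_dist {x a : E} (ha : a ∈ frontier G) : bdist G x ≤ dist x a :=
  infDist_le_dist_of_mem ha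

theorem bdist_le_add (x y : E) : bdist G x ≤ bdist G y + dist x y :=
  infDist_le_infDist_add_dist

theorem bdist_nonneg (x : E) : 0 ≤ bdist G x := infDist_nonneg

/-- A preconnected set that meets `G` but not its boundary lies in `G`. -/
theorem subset_of_disjoint_frontier (hG : IsOpen G) {S : Set E} (hS : IsPreconnected S)
    (hd : ∀ a ∈ S, a ∉ frontier G) {z : E} (hz : z ∈ S) (hzG : z ∈ G) : S ⊆ G := by
  refine hS.subset_left_of_subset_union hG (isClosed_closure (s := G)).isOpen_compl ?_ ?_
    ⟨z, hz, hzG⟩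
  · exact disjoint_compl_right.mono_left subset_closure |>.mono_right le_rfl
  · intro a ha
    by_contra hc
    simp only [mem_union, mem_compl_iff, not_or, not_not] at hc
    exact hd a ha ⟨hc.2, fun h => hc.1 (interior_subset h)⟩

variable [NormedSpace ℝ E]

namespace IsProperDomain

theorem frontier_nonempty (hG : IsProperDomain G) : (frontier G).Nonempty :=
  nonempty_frontier_iff.2 ⟨hG.isConnected.nonempty, hG.ne_univ⟩

theorem bdist_pos (hG : IsProperDomain G) {x : E} (hx : x ∈ G) : 0 < bdist G x := by
  refine (isClosed_frontier.notMem_iff_infDist_pos hG.frontier_nonempty).1 fun h => ?_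
  rw [hG.isOpen.frontier_eq] at h
  exact h.2 hx

theorem exists_dist_lt (hG : IsProperDomain G) {x : E} {r : ℝ} (h : bdist G x < r) :
    ∃ a ∈ frontier G, dist x a < r :=
  (infDist_lt_iff hG.frontier_nonempty).1 h

theorem exists_dist_le_mul (hG : IsProperDomain G) {x : E} (hx : x ∈ G) {r : ℝ} (hr : 1 < r) :
    ∃ a ∈ frontier G, dist x a ≤ r * bdist G x := by
  have := hG.bdist_pos hx
  obtain ⟨a, ha, h⟩ := hG.exists_dist_lt (x := x) (r := r * bdist G x) (by nlinarith)
  exact ⟨a, ha, h.le⟩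

theorem le_bdist (hG : IsProperDomain G) {x : E} {m : ℝ} (h : ∀ a ∈ frontier G, m ≤ dist x a) :
    m ≤ bdist G x :=
  (le_infDist hG.frontier_nonempty).2 h

theorem ball_subset (hG : IsProperDomain G) {x : E} (hx : x ∈ G) : ball x (bdist G x) ⊆ G := by
  refine subset_of_disjoint_frontier hG.isOpen (convex_ball x _).isPreconnected ?_
    (mem_ball_self (hG.bdist_pos hx)) hx
  intro a ha h
  rw [mem_ball, dist_comm] at ha
  exact absurd (bdist_le_dist (x := x) h) (not_le.2 ha)

theorem dist_le_of_relDist_le (hG : IsProperDomain G) {x y : E} (hx : x ∈ G) (hy : y ∈ G) {t : ℝ}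
    (h : relDist G x y ≤ t) : dist x y ≤ t * bdist G x ∧ dist x y ≤ t * bdist G y := by
  have hm : 0 < min (bdist G x) (bdist G y) := lt_min (hG.bdist_pos hx) (hG.bdist_pos hy)
  rw [relDist, div_le_iff₀ hm] at h
  have ht : 0 ≤ t := by
    by_contra ht
    have := dist_nonneg (x := x) (y := y)
    nlinarith
  exact ⟨h.trans (by gcongr; exact min_le_left _ _), h.trans (by gcongr; exact min_le_right _ _)⟩

theorem relDist_le (hG : IsProperDomain G) {x y : E} (hx : x ∈ G) (hy : y ∈ G) {t m : ℝ}
    (h : dist x y ≤ t * m) (ht : 0 ≤ t) (h1 : m ≤ bdist G x) (h2 : m ≤ bdist G y) :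
    relDist G x y ≤ t := by
  have hm : 0 < min (bdist G x) (bdist G y) := lt_min (hG.bdist_pos hx) (hG.bdist_pos hy)
  rw [relDist, div_le_iff₀ hm]
  exact h.trans (by gcongr; exact le_min h1 h2)

end IsProperDomain

end Domain

/-! ### 1-Lipschitz curves and their concatenation -/

section Curves

/-- The curve `c₁` on `[0, l]`, followed by `c₂`. -/
noncomputable def joinCurve {E : Type u} (c₁ : ℝ → E) (l : ℝ) (c₂ : ℝ → E) (t : ℝ) : E :=
  if t ≤ l then c₁ t else c₂ (t - l)

theorem joinCurve_forall {E : Type u} {c₁ c₂ : ℝ → E} {l₁ l₂ : ℝ} {P : ℝ → E → Prop}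
    (h₁ : ∀ s ∈ Icc 0 l₁, P s (c₁ s)) (h₂ : ∀ s ∈ Icc 0 l₂, P (l₁ + s) (c₂ s)) :
    ∀ s ∈ Icc 0 (l₁ + l₂), P s (joinCurve c₁ l₁ c₂ s) := by
  intro s hs
  unfold joinCurve
  split_ifs with h
  · exact h₁ s ⟨hs.1, h⟩
  · have := h₂ (s - l₁) ⟨by linarith, by linarith [hs.2]⟩
    rwa [add_sub_cancel] at this

theorem joinCurve_mapsTo {E : Type u} {c₁ c₂ : ℝ → E} {l₁ l₂ : ℝ} {S : Set E}
    (h₁ : MapsTo c₁ (Icc 0 l₁) S) (h₂ : MapsTo c₂ (Icc 0 l₂) S) :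
    MapsTo (joinCurve c₁ l₁ c₂) (Icc 0 (l₁ + l₂)) S :=
  joinCurve_forall (P := fun _ z => z ∈ S) (fun _ h => h₁ h) (fun _ h => h₂ h)

variable {E : Type u} [NormedAddCommGroup E]

/-- `c` is a `1`-Lipschitz curve on `[0, l]` from `x` to `y`. -/
structure IsCurve (c : ℝ → E) (l : ℝ) (x y : E) : Prop where
  nonneg : 0 ≤ l
  lip : LipschitzOnWith 1 c (Icc 0 l)
  source : c 0 = x
  target : c l = y

namespace IsCurve

variable {c c₁ c₂ : ℝ → E} {l l₁ l₂ : ℝ} {x y z : E}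

theorem dist_le (h : IsCurve c l x y) {s t : ℝ} (hs : s ∈ Icc 0 l) (ht : t ∈ Icc 0 l) :
    dist (c s) (c t) ≤ |s - t| := by
  simpa [Real.dist_eq] using h.lip.dist_le_mul s hs t ht

theorem of_dist_le (hl : 0 ≤ l)
    (h : ∀ s t, 0 ≤ s → s ≤ t → t ≤ l → dist (c s) (c t) ≤ t - s) (hx : c 0 = x) (hy : c l = y) :
    IsCurve c l x y := by
  refine ⟨hl, LipschitzOnWith.of_dist_le_mul fun s hs t ht => ?_, hx, hy⟩
  rw [NNReal.coe_one, one_mul, Real.dist_eq]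
  rcases le_total s t with hst | hst
  · rw [abs_sub_comm, abs_of_nonneg (sub_nonneg.2 hst)]
    exact h s t hs.1 hst ht.2
  · rw [abs_of_nonneg (sub_nonneg.2 hst), dist_comm]
    exact h t s ht.1 hst hs.2

theorem dist_le_sub (h : IsCurve c l x y) {s t : ℝ} (hs : 0 ≤ s) (hst : s ≤ t) (ht : t ≤ l) :
    dist (c s) (c t) ≤ t - s := by
  have := h.dist_le (s := s) (t := t) ⟨hs, hst.trans ht⟩ ⟨hs.trans hst, ht⟩
  rwa [abs_sub_comm, abs_of_nonneg (sub_nonneg.2 hst)] at this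

theorem join (h₁ : IsCurve c₁ l₁ x y) (h₂ : IsCurve c₂ l₂ y z) :
    IsCurve (joinCurve c₁ l₁ c₂) (l₁ + l₂) x z := by
  have n1 := h₁.nonneg
  have n2 := h₂.nonneg
  refine of_dist_le (by linarith) (fun s t hs hst ht => ?_) ?_ ?_
  · unfold joinCurve
    split_ifs with h1 h2 h2
    · exact h₁.dist_le_sub hs hst h2
    · have e1 := h₁.dist_le_sub hs h1 le_rfl
      have e2 := h₂.dist_le_sub le_rfl (t := t - l₁) (by linarith) (by linarith)
      rw [h₁.target] at e1
      rw [h₂.source] at e2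
      have := dist_triangle (c₁ s) y (c₂ (t - l₁))
      linarith
    · exact absurd (hst.trans h2) h1
    · have := h₂.dist_le_sub (s := s - l₁) (t := t - l₁) (by linarith) (by linarith)
        (by linarith)
      linarith
  · simp [joinCurve, n1, h₁.source]
  · unfold joinCurve
    split_ifs with h
    · have : l₂ = 0 := by linarith
      subst this
      rw [add_zero, h₁.target, ← h₂.source, h₂.target]
    · rw [add_sub_cancel_left, h₂.target]

theorem sub_mem {s : ℝ} (hs : s ∈ Icc 0 l) : l - s ∈ Icc 0 l :=
  ⟨by linarith [hs.2], by linarith [hs.1]⟩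

theorem reverse (h : IsCurve c l x y) : IsCurve (fun t => c (l - t)) l y x := by
  refine of_dist_le h.nonneg (fun s t hs hst ht => ?_) (by simp [h.target]) (by simp [h.source])
  have := h.dist_le_sub (s := l - t) (t := l - s) (by linarith) (by linarith) (by linarith)
  rw [dist_comm]
  linarith

/-- The initial part of a curve. -/
theorem initial (h : IsCurve c l x y) {s : ℝ} (hs : s ∈ Icc 0 l) : IsCurve c s x (c s) :=
  ⟨hs.1, h.lip.mono (Icc_subset_Icc_right hs.2), h.source, rfl⟩

/-- The final part of a curve. -/
theorem final (h : IsCurve c l x y) {s : ℝ} (hs : s ∈ Icc 0 l) :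
    IsCurve (fun t => c (s + t)) (l - s) (c s) y := by
  refine of_dist_le (by linarith [hs.2]) (fun a b ha hab hb => ?_) (by simp) (by simp [h.target])
  have := h.dist_le_sub (s := s + a) (t := s + b) (by linarith [hs.1]) (by linarith) (by linarith)
  linarith

theorem const (x : E) : IsCurve (fun _ => x) 0 x x :=
  ⟨le_rfl, LipschitzOnWith.of_dist_le_mul (by simp), rfl, rfl⟩

theorem exists_segment [NormedSpace ℝ E] (x y : E) :
    ∃ c, IsCurve c (dist x y) x y ∧ MapsTo c (Icc 0 (dist x y)) (segment ℝ x y) := by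
  rcases eq_or_ne x y with rfl | hxy
  · refine ⟨fun _ => x, ?_, fun _ _ => left_mem_segment ℝ x x⟩
    rw [dist_self]
    exact const x
  have hd : 0 < dist x y := dist_pos.2 hxy
  refine ⟨fun t => AffineMap.lineMap x y (t / dist x y), of_dist_le hd.le ?_ (by simp) ?_, ?_⟩
  · intro s t hs hst ht
    rw [dist_lineMap_lineMap, Real.dist_eq, ← sub_div, abs_div, abs_of_pos hd,
      div_mul_cancel₀ _ hd.ne', abs_sub_comm, abs_of_nonneg (sub_nonneg.2 hst)]
  · simp [hd.ne']
  · intro t ht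
    rw [segment_eq_image_lineMap]
    exact ⟨_, ⟨div_nonneg ht.1 hd.le, (div_le_one hd).2 ht.2⟩, rfl⟩

theorem eVariationOn_comp_mul_le (h : IsCurve c l x y) {a b : ℝ} (ha : 0 ≤ a) (hb : b ≤ 1) : eVariationOn (fun t => c (l * t)) (Icc a b) ≤ ENNReal.ofReal (l * (b - a)) := by
  have hn := h.nonneg
  refine iSup_le ?_
  rintro ⟨n, u, um, us⟩
  calc
    ∑ i ∈ Finset.range n, edist (c (l * u (i + 1))) (c (l * u i))
        ≤ ∑ i ∈ Finset.range n, ENNReal.ofReal (l * u (i + 1) - l * u i) := by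
      refine Finset.sum_le_sum fun i _ => ?_
      rw [edist_comm, edist_dist]
      refine ENNReal.ofReal_le_ofReal (h.dist_le_sub ?_ ?_ ?_)
      · exact mul_nonneg hn (ha.trans (us i).1)
      · exact mul_le_mul_of_nonneg_left (um (Nat.le_succ i)) hn
      · exact mul_le_of_le_one_right hn ((us (i + 1)).2.trans hb)
    _ = ENNReal.ofReal (l * u n - l * u 0) := by
      rw [← ENNReal.ofReal_sum_of_nonneg, Finset.sum_range_sub (fun i => l * u i)]
      exact fun i _ => sub_nonneg.2 (mul_le_mul_of_nonneg_left (um (Nat.le_succ i)) hn)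
    _ ≤ ENNReal.ofReal (l * (b - a)) := by
      refine ENNReal.ofReal_le_ofReal ?_
      have h1 := (us n).2
      have h2 := (us 0).1
      nlinarith

theorem isRectCurve {G : Set E} [NormedSpace ℝ E] (h : IsCurve c l x y)
    (hG : MapsTo c (Icc 0 l) G) : IsRectCurve G x y (fun t => c (l * t)) := by
  have hm : MapsTo (fun t : ℝ => l * t) (Icc 0 1) (Icc 0 l) := fun t ht =>
    ⟨mul_nonneg h.nonneg ht.1, mul_le_of_le_one_right h.nonneg ht.2⟩
  refine ⟨h.lip.continuousOn.comp (by fun_prop) hm, hG.comp hm, by simp [h.source],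
    by simp [h.target], ?_⟩
  exact ((h.eVariationOn_comp_mul_le le_rfl le_rfl).trans_lt
    ENNReal.ofReal_lt_top).ne

end IsCurve

end Curves

/-! ### Arclength parametrization of rectifiable curves -/

section NaturalParameterization

variable {E : Type u} [NormedAddCommGroup E]

/-- At a point of continuity the variation over a shrinking interval tends to 0 on either side. By
the intermediate value theorem arclength then takes every value up to the total length, so
`naturalParameterization` is controlled on the whole interval. -/
theorem continuousOn_variationOnFromTo {γ : ℝ → E} {s : Set ℝ} (hc : ContinuousOn γ s)
    (hv : BoundedVariationOn γ s) {a : ℝ} (ha : a ∈ s) :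
    ContinuousOn (variationOnFromTo γ s a) s := by
  intro x hx
  have h1 := hv.tendsto_eVariationOn_Icc_zero_left ((hc x hx).mono inter_subset_left)
  have h2 := hv.tendsto_eVariationOn_Icc_zero_right x ((hc x hx).mono inter_subset_left)
  have h1' := (ENNReal.tendsto_toReal ENNReal.zero_ne_top).comp h1
  have h2' := (ENNReal.tendsto_toReal ENNReal.zero_ne_top).comp h2
  have h3 := h1'.add h2'
  rw [ENNReal.toReal_zero, add_zero] at h3
  rw [ContinuousWithinAt, tendsto_iff_dist_tendsto_zero]
  refine squeeze_zero' (Eventually.of_forall fun _ => dist_nonneg) ?_ h3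
  filter_upwards [self_mem_nhdsWithin] with y hy
  rw [Real.dist_eq, variationOnFromTo.sub_right hv.locallyBoundedVariationOn ha hy hx]
  simp only [Function.comp_apply]
  rcases le_total x y with h | h
  · rw [variationOnFromTo.eq_of_le _ _ h, abs_of_nonneg ENNReal.toReal_nonneg]
    simp
  · rw [variationOnFromTo.eq_of_ge _ _ h, abs_neg, abs_of_nonneg ENNReal.toReal_nonneg]
    simp

theorem IsRectCurve.isCurve_naturalParameterization [NormedSpace ℝ E] {G : Set E} {x y : E}
    {γ : ℝ → E} (h : IsRectCurve G x y γ) :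
    IsCurve (naturalParameterization γ (Icc 0 1) 0) (eVariationOn γ (Icc 0 1)).toReal x y ∧
    MapsTo (naturalParameterization γ (Icc 0 1) 0) (Icc 0 (eVariationOn γ (Icc 0 1)).toReal)
      (γ '' Icc 0 1) := by
  have h0 : (0 : ℝ) ∈ Icc (0 : ℝ) 1 := by simp
  have h1 : (1 : ℝ) ∈ Icc (0 : ℝ) 1 := by simp
  have hb : BoundedVariationOn γ (Icc 0 1) := h.rectifiable
  have hl := hb.locallyBoundedVariationOn
  have hv := continuousOn_variationOnFromTo h.continuousOn hb h0
  have hv0 : variationOnFromTo γ (Icc 0 1) 0 0 = 0 := variationOnFromTo.self _ _ _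
  have hv1 : variationOnFromTo γ (Icc 0 1) 0 1 = (eVariationOn γ (Icc 0 1)).toReal := by
    rw [variationOnFromTo.eq_of_le _ _ zero_le_one, inter_self]
  have hs : Icc 0 (eVariationOn γ (Icc 0 1)).toReal ⊆
      variationOnFromTo γ (Icc 0 1) 0 '' Icc 0 1 := by
    have := intermediate_value_Icc zero_le_one hv
    rwa [hv0, hv1] at this
  have hu := has_unit_speed_naturalParameterization γ hl h0
  refine ⟨IsCurve.of_dist_le ENNReal.toReal_nonneg (fun s t hs0 hst ht => ?_) ?_ ?_, ?_⟩
  · have hs' := hs ⟨hs0, hst.trans ht⟩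
    have ht' := hs ⟨hs0.trans hst, ht⟩
    have h2 := eVariationOn.edist_le (naturalParameterization γ (Icc 0 1) 0)
      (s := variationOnFromTo γ (Icc 0 1) 0 '' Icc 0 1 ∩ Icc s t)
      ⟨hs', left_mem_Icc.2 hst⟩ ⟨ht', right_mem_Icc.2 hst⟩
    rw [hu hs' ht', NNReal.coe_one, one_mul, edist_dist] at h2
    exact (ENNReal.ofReal_le_ofReal_iff (sub_nonneg.2 hst)).1 h2
  · have := edist_naturalParameterization_eq_zero hl h0 h0
    rw [hv0, edist_eq_zero] at this
    rw [this, h.source]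
  · have := edist_naturalParameterization_eq_zero hl h0 h1
    rw [hv1, edist_eq_zero] at this
    rw [this, h.target]
  · intro t ht
    have : Nonempty ℝ := ⟨0⟩
    exact ⟨_, Function.invFunOn_mem (hs ht), rfl⟩

end NaturalParameterization

/-! ### Upper and lower estimates for the quasihyperbolic distance -/

section QuasihyperbolicDistance

variable {E : Type u} [NormedAddCommGroup E] [NormedSpace ℝ E] {G : Set E}

theorem IsRectCurve.qhEDist_le {x y : E} {γ : ℝ → E} (h : IsRectCurve G x y γ) {m : ℝ}
    (hm : ∀ t ∈ Icc (0 : ℝ) 1, m ≤ bdist G (γ t)) (hm0 : 0 < m) {l : ℝ}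
    (hlen : eVariationOn γ (Icc 0 1) ≤ ENNReal.ofReal l) :
    qhEDist G x y ≤ ENNReal.ofReal (l / m) := by
  obtain ⟨-, hmaps⟩ := h.isCurve_naturalParameterization
  refine (iInf₂_le γ h).trans ?_
  unfold qhLength
  calc
    _ ≤ ∫⁻ t in Icc 0 (eVariationOn γ (Icc 0 1)).toReal, ENNReal.ofReal (1 / m) := by
      refine MeasureTheory.setLIntegral_mono measurable_const fun t ht => ?_
      obtain ⟨s, hs, hst⟩ := hmaps ht
      rw [← hst]
      exact ENNReal.ofReal_le_ofReal (one_div_le_one_div_of_le hm0 (hm s hs))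
    _ = ENNReal.ofReal (1 / m) * eVariationOn γ (Icc 0 1) := by
      rw [MeasureTheory.setLIntegral_const, Real.volume_Icc, sub_zero,
        ENNReal.ofReal_toReal h.rectifiable]
    _ ≤ ENNReal.ofReal (1 / m) * ENNReal.ofReal l := by gcongr
    _ = ENNReal.ofReal (l / m) := by
      rw [← ENNReal.ofReal_mul (by positivity), one_div, inv_mul_eq_div]

theorem IsCurve.qhEDist_le {c : ℝ → E} {l : ℝ} {x y : E} (h : IsCurve c l x y)
    (hG : MapsTo c (Icc 0 l) G) {m : ℝ} (hm : ∀ t ∈ Icc 0 l, m ≤ bdist G (c t)) (hm0 : 0 < m) :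
    qhEDist G x y ≤ ENNReal.ofReal (l / m) := by
  refine (h.isRectCurve hG).qhEDist_le (fun t ht => hm _ ?_) hm0 ?_
  · exact ⟨mul_nonneg h.nonneg ht.1, mul_le_of_le_one_right h.nonneg ht.2⟩
  · simpa using h.eVariationOn_comp_mul_le (a := 0) (b := 1) le_rfl le_rfl

/-- By connectedness Lipschitz curves join any two points, and d_G has a positive minimum along such
a curve. This makes `qhDist` a faithful version of `qhEDist`. -/
theorem qhEDist_ne_top (hG : IsProperDomain G) {x y : E} (hx : x ∈ G) (hy : y ∈ G) :
    qhEDist G x y ≠ ∞ := by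
  obtain ⟨c, l, hc, hcG⟩ : ∃ c l, IsCurve c l x y ∧ MapsTo c (Icc 0 l) G := by
    refine hG.isConnected.isPreconnected.induction₂
      (fun x y => ∃ c l, IsCurve c l x y ∧ MapsTo c (Icc 0 l) G) (fun x hx => ?_) ?_ ?_ hx hy
    · filter_upwards [mem_nhdsWithin_of_mem_nhds (ball_mem_nhds x (hG.bdist_pos hx))] with y hy
      obtain ⟨c, hc, hcs⟩ := IsCurve.exists_segment x y
      exact ⟨c, _, hc, fun t ht => hG.ball_subset hx <|
        (convex_ball x _).segment_subset (mem_ball_self (hG.bdist_pos hx)) hy (hcs ht)⟩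
    · rintro x y z - - - ⟨c, l, hc, hcG⟩ ⟨c', l', hc', hcG'⟩
      exact ⟨_, _, hc.join hc', joinCurve_mapsTo hcG hcG'⟩
    · rintro x y - - ⟨c, l, hc, hcG⟩
      exact ⟨_, _, hc.reverse, fun t ht => hcG (IsCurve.sub_mem ht)⟩
  obtain ⟨t, ht, hmin⟩ := isCompact_Icc.exists_isMinOn ⟨0, left_mem_Icc.2 hc.nonneg⟩
    ((continuous_infDist_pt (frontier G)).comp_continuousOn hc.lip.continuousOn)
  exact ((hc.qhEDist_le hcG (fun s hs => hmin hs) (hG.bdist_pos (hcG ht))).trans_lt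
    ENNReal.ofReal_lt_top).ne

theorem ofReal_qhDist (hG : IsProperDomain G) {x y : E} (hx : x ∈ G) (hy : y ∈ G) :
    ENNReal.ofReal (qhDist G x y) = qhEDist G x y :=
  ENNReal.ofReal_toReal (qhEDist_ne_top hG hx hy)

theorem qhEDist_le_ofReal_iff (hG : IsProperDomain G) {x y : E} (hx : x ∈ G) (hy : y ∈ G) {K : ℝ}
    (hK : 0 ≤ K) : qhEDist G x y ≤ ENNReal.ofReal K ↔ qhDist G x y ≤ K := by
  rw [← ofReal_qhDist hG hx hy, ENNReal.ofReal_le_ofReal_iff hK]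

theorem setLIntegral_inv_add {m l : ℝ} (hm : 0 < m) (hl : 0 ≤ l) :
    ∫⁻ t in Icc 0 l, ENNReal.ofReal (1 / (m + t)) = ENNReal.ofReal (Real.log ((m + l) / m)) := by
  have hcont : ContinuousOn (fun t : ℝ => 1 / (m + t)) (Icc 0 l) :=
    continuousOn_const.div (by fun_prop) fun t ht => by linarith [ht.1]
  rw [← MeasureTheory.ofReal_integral_eq_lintegral_ofReal hcont.integrableOn_Icc,
    MeasureTheory.integral_Icc_eq_integral_Ioc, ← intervalIntegral.integral_of_le hl]
  · congr 1
    rw [intervalIntegral.integral_comp_add_left (fun t => 1 / t), add_zero]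
    rw [integral_one_div_of_pos hm (by linarith)]
  · filter_upwards [MeasureTheory.ae_restrict_mem measurableSet_Icc] with t ht
    have := ht.1
    simp only [Pi.zero_apply]
    positivity

theorem setLIntegral_inv_add_sub {m l : ℝ} (hm : 0 < m) (hl : 0 ≤ l) :
    ∫⁻ t in Icc 0 l, ENNReal.ofReal (1 / (m + (l - t))) =
      ENNReal.ofReal (Real.log ((m + l) / m)) := by
  have hcont : ContinuousOn (fun t : ℝ => 1 / (m + (l - t))) (Icc 0 l) :=
    continuousOn_const.div (by fun_prop) fun t ht => by linarith [ht.2]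
  rw [← MeasureTheory.ofReal_integral_eq_lintegral_ofReal hcont.integrableOn_Icc,
    MeasureTheory.integral_Icc_eq_integral_Ioc, ← intervalIntegral.integral_of_le hl]
  · congr 1
    rw [intervalIntegral.integral_comp_sub_left (fun t => 1 / (m + t)),
      intervalIntegral.integral_comp_add_left (fun t => 1 / t), sub_self, sub_zero, add_zero,
      integral_one_div_of_pos hm (by linarith)]
  · filter_upwards [MeasureTheory.ae_restrict_mem measurableSet_Icc] with t ht
    have := sub_nonneg.2 ht.2
    simp only [Pi.zero_apply]
    positivity

/-- A curve of small quasihyperbolic length is short compared with the boundary distance of its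
initial point, and stays away from the boundary. -/
theorem exists_isCurve_of_qhEDist_lt (hG : IsProperDomain G) {x y : E} {K : ℝ}
    (h : qhEDist G x y < ENNReal.ofReal K) :
    ∃ c l, IsCurve c l x y ∧ MapsTo c (Icc 0 l) G ∧ l ≤ Real.exp K * bdist G x ∧
      ∀ t ∈ Icc 0 l, bdist G x ≤ Real.exp K * bdist G (c t) := by
  unfold qhEDist at h
  simp only [iInf_lt_iff] at h
  obtain ⟨γ, hγ, hlt⟩ := h
  obtain ⟨hc, hmaps⟩ := hγ.isCurve_naturalParameterization
  set n := naturalParameterization γ (Icc 0 1) 0 with hn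
  set l := (eVariationOn γ (Icc 0 1)).toReal with hl
  have hnG : MapsTo n (Icc 0 l) G := fun t ht => by
    obtain ⟨s, hs, hst⟩ := hmaps ht
    exact hst ▸ hγ.mapsTo hs
  have hK : 0 < K := by
    by_contra hK
    rw [ENNReal.ofReal_of_nonpos (not_lt.1 hK)] at hlt
    exact not_lt_bot hlt
  -- As d_G is 1-Lipschitz, the quasihyperbolic length is at least log((m + t₀)/m). With m = d_G(x)
  -- and `φ t = t` this bounds the length; with m = d_G at time t₀ and `φ t = t₀ - t` it bounds d_G
  -- there from below.
  have key : ∀ m t₀ : ℝ, 0 < m → 0 ≤ t₀ → t₀ ≤ l → (∀ φ : ℝ → ℝ,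
      (∫⁻ t in Icc 0 t₀, ENNReal.ofReal (1 / (m + φ t)) =
        ENNReal.ofReal (Real.log ((m + t₀) / m))) →
      (∀ t ∈ Icc 0 t₀, bdist G (n t) ≤ m + φ t) → m + t₀ ≤ Real.exp K * m) := by
    intro m t₀ hm ht₀ ht₀l φ hφ hle
    have h1 : ENNReal.ofReal (Real.log ((m + t₀) / m)) < ENNReal.ofReal K := by
      rw [← hφ]
      refine lt_of_le_of_lt ?_ hlt
      calc
        _ ≤ ∫⁻ t in Icc 0 t₀, ENNReal.ofReal (1 / bdist G (n t)) := by
          refine MeasureTheory.setLIntegral_mono' measurableSet_Icc fun t ht => ?_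
          exact ENNReal.ofReal_le_ofReal (one_div_le_one_div_of_le
            (hG.bdist_pos (hnG ⟨ht.1, ht.2.trans ht₀l⟩)) (hle t ht))
        _ ≤ _ := MeasureTheory.lintegral_mono_set (Icc_subset_Icc_right ht₀l)
    have h2 := (Real.log_lt_iff_lt_exp (by positivity)).1 (ENNReal.ofReal_lt_ofReal_iff hK |>.1 h1)
    exact ((div_lt_iff₀ hm).1 h2).le
  have hx : 0 < bdist G x := by
    have := hG.bdist_pos (hnG ⟨le_rfl, hc.nonneg⟩)
    rwa [hc.source] at this
  refine ⟨n, l, hc, hnG, ?_, fun t₀ ht₀ => ?_⟩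
  · have := key (bdist G x) l hx hc.nonneg le_rfl (fun t => t)
      (setLIntegral_inv_add hx hc.nonneg) fun t ht => ?_
    · linarith
    · have h1 := hc.dist_le_sub le_rfl ht.1 ht.2
      have h2 := bdist_le_add (G := G) (n t) (n 0)
      rw [dist_comm, hc.source] at h2
      rw [hc.source] at h1
      linarith
  · have := key (bdist G (n t₀)) t₀ (hG.bdist_pos (hnG ht₀)) ht₀.1 ht₀.2 (fun t => t₀ - t)
      (setLIntegral_inv_add_sub (hG.bdist_pos (hnG ht₀)) ht₀.1) fun t ht => ?_
    · have h1 := hc.dist_le_sub le_rfl ht₀.1 ht₀.2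
      have h2 := bdist_le_add (G := G) x (n t₀)
      rw [hc.source] at h1
      linarith
    · have h1 := hc.dist_le_sub ht.1 ht.2 ht₀.2
      have h2 := bdist_le_add (G := G) (n t) (n t₀)
      linarith

end QuasihyperbolicDistance

/-! ### Going around a ball in dimension at least two -/

section Exterior

variable {E : Type u} [NormedAddCommGroup E] [NormedSpace ℝ E]

/-- Riesz's lemma for the span of p, which is a proper closed subspace. It replaces a choice of a
vector orthogonal to p. -/
theorem exists_norm_eq_one_le_norm_sub_smul (hE : 2 ≤ Module.rank ℝ E) (p : E) :
    ∃ e : E, ‖e‖ = 1 ∧ ∀ r : ℝ, 1 / 2 ≤ ‖e - r • p‖ := by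
  have hF : ∃ x : E, x ∉ Submodule.span ℝ {p} := by
    by_contra! h
    have htop : Submodule.span ℝ {p} = ⊤ := eq_top_iff.2 fun x _ => h x
    have h1 : Module.rank ℝ (Submodule.span ℝ {p}) ≤ 1 := by
      simpa using rank_span_le (R := ℝ) ({p} : Set E)
    rw [htop, rank_top] at h1
    exact absurd (hE.trans h1) (by norm_num)
  obtain ⟨e, -, he, h⟩ := riesz_lemma_of_lt_one (𝕜 := ℝ)
    (Submodule.closed_of_finiteDimensional (Submodule.span ℝ {p})) hF (r := 1 / 2) (by norm_num)
  exact ⟨e, he, fun r => h _ (Submodule.smul_mem _ _ (Submodule.mem_span_singleton_self p))⟩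

/-- If the weight of σe is at least 1/4, the distance of e from the line ℝp gives the bound;
otherwise the term in p dominates. -/
theorem le_norm_of_mem_segment_smul {p e : E} {m σ : ℝ} (hm : 0 < m) (hp : m ≤ ‖p‖)
    (hσ : |σ| = m) (he1 : ‖e‖ = 1) (he : ∀ r : ℝ, 1 / 2 ≤ ‖e - r • p‖) :
    ∀ z ∈ segment ℝ p (σ • e), m / 8 ≤ ‖z‖ := by
  rintro z ⟨α, β, hα, hβ, hαβ, rfl⟩
  rcases le_total (1 / 4) β with h | h
  · have hβ0 : 0 < β := by linarith
    have hσ0 : σ ≠ 0 := by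
      rintro rfl
      simp at hσ
      linarith
    have : α • p + β • σ • e = (β * σ) • (e - (-(α / (β * σ))) • p) := by
      rw [smul_sub, smul_smul, smul_smul]
      have : β * σ * -(α / (β * σ)) = -α := by field_simp
      rw [this, neg_smul, sub_neg_eq_add, add_comm]
    rw [this, norm_smul, Real.norm_eq_abs, abs_mul, hσ, abs_of_pos hβ0]
    have := he (-(α / (β * σ)))
    have h2 : m / 4 ≤ β * m := by nlinarith
    nlinarith
  · have h1 := norm_sub_le_norm_add (α • p) (β • σ • e)
    rw [norm_smul, norm_smul, norm_smul, Real.norm_eq_abs, Real.norm_eq_abs, Real.norm_eq_abs,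
      abs_of_nonneg hα, abs_of_nonneg hβ, hσ, he1] at h1
    nlinarith

/-- A segment from e to q that passes near 0 forces q to point roughly along -e, so the segment from
-e cannot come near 0 as well. Eliminating q from two small combinations leaves a multiple of e that
is too large, unless the first point is e itself. -/
theorem le_norm_of_mem_segment_neg {q e : E} {m : ℝ} (hm : 0 < m) (hq : m ≤ ‖q‖) (he : ‖e‖ = m)
    {z : E} (hz : z ∈ segment ℝ e q) (hzm : ‖z‖ < m / 8) :
    ∀ w ∈ segment ℝ (-e) q, m / 8 ≤ ‖w‖ := by
  obtain ⟨α, l, hα, hl, hαl, rfl⟩ := hz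
  rintro w ⟨β, k, hβ, hk, hβk, rfl⟩
  by_contra! hw
  have hl' : l * m < m / 8 + α * m := by
    have h1 := norm_sub_norm_le (l • q) (-(α • e))
    rw [sub_neg_eq_add, add_comm (l • q), norm_neg, norm_smul, norm_smul, Real.norm_eq_abs,
      Real.norm_eq_abs, abs_of_nonneg hα, abs_of_nonneg hl, he] at h1
    nlinarith
  have hk' : k * m < m / 8 + β * m := by
    have h1 := norm_sub_norm_le (k • q) (β • e)
    rw [show k • q - β • e = β • -e + k • q by module, norm_smul, norm_smul, Real.norm_eq_abs,
      Real.norm_eq_abs, abs_of_nonneg hβ, abs_of_nonneg hk, he] at h1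
    nlinarith
  have hl1 : l ≤ 9 / 16 := by nlinarith
  have hk1 : k ≤ 9 / 16 := by nlinarith
  have hsum : k • (α • e + l • q) - l • (β • -e + k • q) = (k * α + l * β) • e := by
    module
  have h2 := norm_sub_le (k • (α • e + l • q)) (l • (β • -e + k • q))
  rw [hsum, norm_smul, norm_smul, norm_smul, Real.norm_eq_abs, Real.norm_eq_abs, Real.norm_eq_abs,
    abs_of_nonneg hk, abs_of_nonneg hl, abs_of_nonneg (by positivity), he] at h2
  have h3 : (k * α + l * β) * m ≤ (k + l) * (1 / 8) * m := by nlinarith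
  have h4 := le_of_mul_le_mul_right h3 hm
  have hl0 : l ≤ 0 := by
    have : α = 1 - l := by linarith
    have : β = 1 - k := by linarith
    subst α β
    nlinarith
  have hl0' : l = 0 := le_antisymm hl0 hl
  have hα1 : α = 1 := by linarith
  rw [hl0', hα1, zero_smul, add_zero, one_smul, he] at hzm
  linarith

/-- The turning point is b + me or b - me, with e nearly orthogonal to p - b. Either sign is good
for p, and at least one is good for q. -/
theorem exists_segments_avoiding_ball (hE : 2 ≤ Module.rank ℝ E) {p q b : E} {m : ℝ} (hm : 0 < m)
    (hp : m ≤ dist p b) (hq : m ≤ dist q b) :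
    ∃ e : E, (∀ z ∈ segment ℝ p e, m / 8 ≤ dist z b) ∧ (∀ z ∈ segment ℝ e q, m / 8 ≤ dist z b) ∧
      dist p e + dist e q ≤ 2 * (dist p b + dist q b) := by
  rw [dist_eq_norm] at hp hq
  have shift : ∀ {x y z : E}, z ∈ segment ℝ x (b + y) → z - b ∈ segment ℝ (x - b) y := by
    intro x y z hz
    rw [← mem_segment_translate ℝ b]
    simpa using hz
  have shift' : ∀ {x y z : E}, z ∈ segment ℝ (b + y) x → z - b ∈ segment ℝ y (x - b) := by
    intro x y z hz
    rw [segment_symm] at hz ⊢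
    exact shift hz
  obtain ⟨e, he1, he⟩ := exists_norm_eq_one_le_norm_sub_smul hE (p - b)
  suffices h : ∃ σ : ℝ, |σ| = m ∧ ∀ z ∈ segment ℝ (σ • e) (q - b), m / 8 ≤ ‖z‖ by
    obtain ⟨σ, hσ, h⟩ := h
    refine ⟨b + σ • e, fun z hz => ?_, fun z hz => ?_, ?_⟩
    · rw [dist_eq_norm]
      exact le_norm_of_mem_segment_smul hm hp hσ he1 he _ (shift hz)
    · rw [dist_eq_norm]
      exact h _ (shift' hz)
    · have h1 : dist b (b + σ • e) = m := by
        rw [dist_self_add_right, norm_smul, he1, mul_one, Real.norm_eq_abs, hσ]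
      have h2 := dist_triangle p b (b + σ • e)
      have h3 := dist_triangle_left (b + σ • e) q b
      rw [dist_comm b q] at h3
      rw [← dist_eq_norm] at hp hq
      linarith
  by_cases h : ∀ z ∈ segment ℝ (m • e) (q - b), m / 8 ≤ ‖z‖
  · exact ⟨m, abs_of_pos hm, h⟩
  · push Not at h
    obtain ⟨z, hz, hzm⟩ := h
    refine ⟨-m, by rw [abs_neg, abs_of_pos hm], ?_⟩
    rw [neg_smul]
    refine le_norm_of_mem_segment_neg hm hq ?_ hz hzm
    rw [norm_smul, he1, mul_one, Real.norm_eq_abs, abs_of_pos hm]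

theorem qhEDist_le_of_frontier_subset {G : Set E} (hE : 2 ≤ Module.rank ℝ E)
    (hG : IsProperDomain G) {p q b : E} {m : ℝ} (hm : 0 < m)
    (hb : ∀ a ∈ frontier G, dist a b ≤ m / 16) (hpG : p ∈ G)
    (hp : m ≤ dist p b) (hq : m ≤ dist q b) :
    qhEDist G p q ≤ ENNReal.ofReal (32 * (dist p b + dist q b) / m) := by
  obtain ⟨e, h1, h2, hlen⟩ := exists_segments_avoiding_ball hE hm hp hq
  obtain ⟨c₁, hc₁, hs₁⟩ := IsCurve.exists_segment p e
  obtain ⟨c₂, hc₂, hs₂⟩ := IsCurve.exists_segment e q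
  have hc := hc₁.join hc₂
  have haway : ∀ z, m / 8 ≤ dist z b → m / 16 ≤ bdist G z := fun z hz =>
    hG.le_bdist fun a ha => by
      have := dist_triangle z a b
      have := hb a ha
      linarith
  have hfront : ∀ z, m / 8 ≤ dist z b → z ∉ frontier G := fun z hz h => by
    have := hb z h
    linarith
  have hpe : segment ℝ p e ⊆ G := subset_of_disjoint_frontier hG.isOpen
    (convex_segment p e).isPreconnected (fun z hz => hfront z (h1 z hz)) (left_mem_segment ℝ p e)
    hpG
  have heq : segment ℝ e q ⊆ G := subset_of_disjoint_frontier hG.isOpen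
    (convex_segment e q).isPreconnected (fun z hz => hfront z (h2 z hz)) (left_mem_segment ℝ e q)
    (hpe (right_mem_segment ℝ p e))
  refine (hc.qhEDist_le (joinCurve_mapsTo (hs₁.mono_right hpe) (hs₂.mono_right heq))
    (m := m / 16) (joinCurve_forall (P := fun _ z => m / 16 ≤ bdist G z)
      (fun s hs => haway _ (h1 _ (hs₁ hs))) (fun s hs => haway _ (h2 _ (hs₂ hs))))
    (by positivity)).trans ?_
  refine ENNReal.ofReal_le_ofReal ?_
  rw [div_le_div_iff₀ (by positivity) hm]
  nlinarith

end Exterior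

/-! ### Control functions derived from η -/

section ControlFunctions

variable (η : ℝ≥0 ≃ₜ ℝ≥0)

/-- A continuous injection is strictly increasing or strictly decreasing, and a decreasing one would
be bounded by its value at 0. -/
theorem strictMono_of_homeomorph : StrictMono η := by
  rcases η.continuous.strictMono_of_inj η.injective with h | h
  · exact h
  · obtain ⟨x, hx⟩ := η.surjective (η 0 + 1)
    have h1 := h.antitone (zero_le (a := x))
    rw [hx] at h1
    exact absurd h1 (not_le.2 (lt_add_one _))

theorem homeomorph_symm_pos {t : ℝ≥0} (ht : 0 < t) : 0 < η.symm t := by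
  have h : η 0 = 0 := by
    obtain ⟨x, hx⟩ := η.surjective 0
    exact le_antisymm (((strictMono_of_homeomorph η).monotone (zero_le (a := x))).trans_eq hx) zero_le
  refine pos_iff_ne_zero.2 fun h0 => ht.ne ?_
  rw [← h, ← h0, η.apply_symm_apply]

/-- Upper bound for the cross ratios of the image, in terms of those of the source. -/
noncomputable def upperControl (T : ℝ) : ℝ := η T.toNNReal + 1

/-- Upper bound for the cross ratios of the source, in terms of those of the image. -/
noncomputable def lowerControl (T : ℝ) : ℝ := ((η.symm (T⁻¹).toNNReal : ℝ≥0) : ℝ)⁻¹ + 1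

theorem one_le_upperControl (T : ℝ) : 1 ≤ upperControl η T := by simp [upperControl]

theorem one_le_lowerControl (T : ℝ) : 1 ≤ lowerControl η T := by simp [lowerControl]

end ControlFunctions

/-! ### Cross ratios with a point at infinity -/

section ExtDist

variable {E : Type u} [NormedAddCommGroup E]

/-- The distance in `Ė` between an arbitrary and a finite point, where `∞` is placed at
distance `N` from all finite points. -/
noncomputable def extDist (N : ℝ) : Ext E → E → ℝ
  | Ext.fin a, y => dist a y
  | Ext.infty, _ => N

theorem extDist_fin (N : ℝ) (a y : E) : extDist N (Ext.fin a) y = dist a y := rfl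

theorem extDist_infty (N : ℝ) (y : E) : extDist N Ext.infty y = N := rfl

theorem extDist_nonneg {N : ℝ} (hN : 0 < N) (a : Ext E) (y : E) : 0 ≤ extDist N a y := by
  cases a with
  | infty => exact hN.le
  | fin a => exact dist_nonneg

theorem extDist_pos {N : ℝ} (hN : 0 < N) {a : Ext E} {y : E} (h : a ≠ Ext.fin y) :
    0 < extDist N a y := by
  cases a with
  | infty => exact hN
  | fin a => exact dist_pos.2 fun h' => h (h' ▸ rfl)

/-- A factor N always occurs together with its inverse, so N > 0 is free. This lets ∞ be treated as
a very remote point by taking N large. -/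
theorem coe_crossRatio {N : ℝ} (hN : 0 < N) (a b : Ext E) (y z : E) :
    (Ext.crossRatio a (Ext.fin y) (Ext.fin z) b : ℝ) =
      extDist N a z / extDist N a y * (extDist N b y / extDist N b z) := by
  have h1 : ∀ a : Ext E, ((Ext.gap a (Ext.fin z) / Ext.gap a (Ext.fin y) : ℝ≥0) : ℝ) =
      extDist N a z / extDist N a y := by
    intro a
    cases a with
    | infty => simp [Ext.gap, extDist, hN.ne']
    | fin a => simp [Ext.gap, extDist]
  have h2 : ∀ a : Ext E, ((Ext.gap (Ext.fin y) a / Ext.gap (Ext.fin z) a : ℝ≥0) : ℝ) =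
      extDist N a y / extDist N a z := by
    intro a
    cases a with
    | infty => simp [Ext.gap, extDist, hN.ne']
    | fin a => simp [Ext.gap, extDist, dist_comm]
  rw [Ext.crossRatio, NNReal.coe_mul, h1, h2]

end ExtDist

/-! ### The quasimöbius condition for two boundary points and two interior points -/

section Boundary

variable {E : Type u} [NormedAddCommGroup E] {E' : Type v} [NormedAddCommGroup E']

/-- A bijection `Φ` between the boundaries of `G` and `G'` (norm boundaries, or these together
with `∞`) such that `f` and `Φ` satisfy the relative quasimöbius condition. -/
structure IsBoundaryQM (η : ℝ≥0 ≃ₜ ℝ≥0) {G : Set E} {G' : Set E'} (f : G ≃ₜ G')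
    {A : Set (Ext E)} {A' : Set (Ext E')} (Φ : A ≃ A') : Prop where
  mem_left : ∀ x, Ext.fin x ∈ A ↔ x ∈ frontier G
  mem_right : ∀ x, Ext.fin x ∈ A' ↔ x ∈ frontier G'
  crossRatio_le : ∀ a b : A, a ≠ b → ∀ y z : G, y ≠ z →
    Ext.crossRatio (Φ a : Ext E') (Ext.fin (f y)) (Ext.fin (f z)) (Φ b) ≤
      η (Ext.crossRatio (a : Ext E) (Ext.fin y) (Ext.fin z) b)

theorem Ext.isOpenEmbedding_fin : IsOpenEmbedding (Ext.fin : E → Ext E) := by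
  have hinj : Function.Injective (Ext.fin : E → Ext E) := fun x y h => Ext.fin.inj h
  refine .of_continuous_injective_isOpenMap ⟨fun s hs => hs.1⟩ hinj fun s hs => ⟨?_, ?_⟩
  · rwa [preimage_image_eq _ hinj]
  · rintro ⟨x, -, hx⟩
    cases hx

namespace IsBoundaryQM

variable {η : ℝ≥0 ≃ₜ ℝ≥0} {G : Set E} {G' : Set E'} {f : G ≃ₜ G'}
  {A : Set (Ext E)} {A' : Set (Ext E')} {Φ : A ≃ A'}

theorem extDist_pos_left (h : IsBoundaryQM η f Φ) (hG : IsOpen G) {N : ℝ} (hN : 0 < N) (a : A)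
    (y : G) : 0 < extDist N (a : Ext E) y := by
  refine extDist_pos hN fun h' => ?_
  have := (h.mem_left y).1 (h' ▸ a.2)
  rw [hG.frontier_eq] at this
  exact this.2 y.2

theorem extDist_pos_right (h : IsBoundaryQM η f Φ) (hG' : IsOpen G') {N : ℝ} (hN : 0 < N) (a : A')
    (y : G') : 0 < extDist N (a : Ext E') y := by
  refine extDist_pos hN fun h' => ?_
  have := (h.mem_right y).1 (h' ▸ a.2)
  rw [hG'.frontier_eq] at this
  exact this.2 y.2

theorem upper (h : IsBoundaryQM η f Φ) (hG : IsOpen G) (hG' : IsOpen G') {N N' : ℝ} (hN : 0 < N)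
    (hN' : 0 < N') {T : ℝ} {a b : A} {y z : G}
    (hT : extDist N (a : Ext E) z * extDist N (b : Ext E) y ≤
      T * (extDist N (a : Ext E) y * extDist N (b : Ext E) z)) :
    extDist N' (Φ a : Ext E') (f z) * extDist N' (Φ b : Ext E') (f y) ≤
      upperControl η T * (extDist N' (Φ a : Ext E') (f y) * extDist N' (Φ b : Ext E') (f z)) := by
  have p1 := h.extDist_pos_right hG' hN' (Φ a) (f y)
  have p2 := h.extDist_pos_right hG' hN' (Φ b) (f z)
  -- The quasimöbius condition concerns distinct points only. If two coincide, the ratio is 1, which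
  -- the summand 1 in `upperControl` covers.
  rcases eq_or_ne a b with rfl | hab
  · rw [mul_comm]
    exact le_mul_of_one_le_left (by positivity) (one_le_upperControl η T)
  rcases eq_or_ne y z with rfl | hyz
  · exact le_mul_of_one_le_left (by positivity) (one_le_upperControl η T)
  have q1 := h.extDist_pos_left hG hN a y
  have q2 := h.extDist_pos_left hG hN b z
  have h1 : Ext.crossRatio (a : Ext E) (Ext.fin y) (Ext.fin z) b ≤ T.toNNReal := by
    have q3 := h.extDist_pos_left hG hN a z
    have q4 := h.extDist_pos_left hG hN b y
    have hT0 : 0 < T * (extDist N (a : Ext E) y * extDist N (b : Ext E) z) :=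
      lt_of_lt_of_le (by positivity) hT
    rw [← NNReal.coe_le_coe, Real.coe_toNNReal _ (pos_of_mul_pos_left hT0 (by positivity)).le,
      coe_crossRatio hN, div_mul_div_comm, div_le_iff₀ (by positivity)]
    exact hT
  have h2 := (h.crossRatio_le a b hab y z hyz).trans ((strictMono_of_homeomorph η).monotone h1)
  rw [← NNReal.coe_le_coe, coe_crossRatio hN', div_mul_div_comm, div_le_iff₀ (by positivity)] at h2
  refine h2.trans ?_
  rw [upperControl]
  gcongr
  linarith

/-- Exchanging y and z inverts the cross ratio, so the condition for the exchanged quadruple bounds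
the source from the image. -/
theorem lower (h : IsBoundaryQM η f Φ) (hG : IsOpen G) (hG' : IsOpen G') {N N' : ℝ} (hN : 0 < N)
    (hN' : 0 < N') {T : ℝ} {a b : A} {y z : G}
    (hT : extDist N' (Φ a : Ext E') (f z) * extDist N' (Φ b : Ext E') (f y) ≤
      T * (extDist N' (Φ a : Ext E') (f y) * extDist N' (Φ b : Ext E') (f z))) :
    extDist N (a : Ext E) z * extDist N (b : Ext E) y ≤
      lowerControl η T * (extDist N (a : Ext E) y * extDist N (b : Ext E) z) := by
  have q1 := h.extDist_pos_left hG hN a y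
  have q2 := h.extDist_pos_left hG hN b z
  have q3 := h.extDist_pos_left hG hN a z
  have q4 := h.extDist_pos_left hG hN b y
  rcases eq_or_ne a b with rfl | hab
  · rw [mul_comm]
    exact le_mul_of_one_le_left (by positivity) (one_le_lowerControl η T)
  rcases eq_or_ne y z with rfl | hyz
  · exact le_mul_of_one_le_left (by positivity) (one_le_lowerControl η T)
  have p1 := h.extDist_pos_right hG' hN' (Φ a) (f y)
  have p2 := h.extDist_pos_right hG' hN' (Φ b) (f z)
  have p3 := h.extDist_pos_right hG' hN' (Φ a) (f z)
  have p4 := h.extDist_pos_right hG' hN' (Φ b) (f y)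
  have hT0 : 0 < T := by
    have : 0 < T * (extDist N' (Φ a : Ext E') (f y) * extDist N' (Φ b : Ext E') (f z)) :=
      lt_of_lt_of_le (by positivity) hT
    exact pos_of_mul_pos_left this (by positivity)
  have h1 : (T⁻¹).toNNReal ≤ η (Ext.crossRatio (a : Ext E) (Ext.fin z) (Ext.fin y) b) := by
    refine le_trans ?_ (h.crossRatio_le a b hab z y hyz.symm)
    rw [Real.toNNReal_le_iff_le_coe, coe_crossRatio hN', div_mul_div_comm,
      le_div_iff₀ (by positivity), inv_mul_le_iff₀ hT0]
    exact hT
  have h2 : η.symm (T⁻¹).toNNReal ≤ Ext.crossRatio (a : Ext E) (Ext.fin z) (Ext.fin y) b := by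
    rwa [← (strictMono_of_homeomorph η).le_iff_le, η.apply_symm_apply]
  have h3 : 0 < η.symm (T⁻¹).toNNReal :=
    homeomorph_symm_pos η (Real.toNNReal_pos.2 (inv_pos.2 hT0))
  rw [← NNReal.coe_le_coe, coe_crossRatio hN, div_mul_div_comm, le_div_iff₀ (by positivity)] at h2
  have h4 : (0 : ℝ) < η.symm (T⁻¹).toNNReal := h3
  rw [← le_inv_mul_iff₀ h4] at h2
  refine h2.trans ?_
  rw [lowerControl]
  gcongr
  linarith

/-- Contrapositive of `upper`: a source ratio above ε has reciprocal below 1/ε, and then the image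
ratio is not small either. -/
theorem small (h : IsBoundaryQM η f Φ) (hG : IsOpen G) (hG' : IsOpen G') {N N' : ℝ} (hN : 0 < N)
    (hN' : 0 < N') {ε ε' : ℝ} (hε : 0 < ε) (hε' : upperControl η ε⁻¹ * ε' < 1) {a b : A} {y z : G}
    (hT : extDist N' (Φ a : Ext E') (f z) * extDist N' (Φ b : Ext E') (f y) ≤
      ε' * (extDist N' (Φ a : Ext E') (f y) * extDist N' (Φ b : Ext E') (f z))) :
    extDist N (a : Ext E) z * extDist N (b : Ext E) y ≤
      ε * (extDist N (a : Ext E) y * extDist N (b : Ext E) z) := by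
  by_contra! hc
  have h1 : extDist N (a : Ext E) y * extDist N (b : Ext E) z ≤
      ε⁻¹ * (extDist N (a : Ext E) z * extDist N (b : Ext E) y) :=
    (le_inv_mul_iff₀ hε).2 hc.le
  have h2 := h.upper hG hG' hN hN' h1
  have p1 := h.extDist_pos_right hG' hN' (Φ a) (f y)
  have p2 := h.extDist_pos_right hG' hN' (Φ b) (f z)
  have p3 : 0 < extDist N' (Φ a : Ext E') (f y) * extDist N' (Φ b : Ext E') (f z) := by positivity
  have h3 := mul_le_mul_of_nonneg_left hT (zero_le_one.trans (one_le_upperControl η ε⁻¹))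
  nlinarith

end IsBoundaryQM

end Boundary

/-! ### From the extension of f to a correspondence of boundaries -/

section Extension

variable {E : Type u} [NormedAddCommGroup E] {E' : Type v} [NormedAddCommGroup E']

/-- This serves both kinds of closure: in each, the boundary is the closure without G, and a
bijection extending f maps it onto the boundary of G'. -/
theorem exists_isBoundaryQM_of_extends {η : ℝ≥0 ≃ₜ ℝ≥0} {G : Set E} {G' : Set E'} {f : G ≃ₜ G'}
    (hG : IsOpen G) (hG' : IsOpen G') {X : Set (Ext E)} {X' : Set (Ext E')}
    (hX : ∀ x, Ext.fin x ∈ X ↔ x ∈ closure G) (hX' : ∀ x, Ext.fin x ∈ X' ↔ x ∈ closure G')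
    (h : ExtendsQMRel η f X X' (X \ Ext.fin '' G)) :
    ∃ (A : Set (Ext E)) (A' : Set (Ext E')) (Φ : A ≃ A'), IsBoundaryQM η f Φ := by
  obtain ⟨F, hF, hqm⟩ := h
  have hinj : Function.Injective (Ext.fin : E → Ext E) := Ext.isOpenEmbedding_fin.injective
  have hinj' : Function.Injective (Ext.fin : E' → Ext E') := Ext.isOpenEmbedding_fin.injective
  have hGX : ∀ x : G, Ext.fin (x : E) ∈ X := fun x => (hX x).2 (subset_closure x.2)
  have hFG : ∀ p : X, (F p : Ext E') ∈ Ext.fin '' G' ↔ (p : Ext E) ∈ Ext.fin '' G := by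
    intro p
    constructor
    · rintro ⟨x', hx', hp⟩
      have h1 := hF (f.symm ⟨x', hx'⟩) ⟨_, hGX _⟩ rfl
      rw [f.apply_symm_apply, hp] at h1
      have h2 := congrArg Subtype.val (F.injective (Subtype.ext h1))
      exact h2 ▸ ⟨_, (f.symm ⟨x', hx'⟩).2, rfl⟩
    · rintro ⟨x, hx, hp⟩
      rw [hF ⟨x, hx⟩ p hp.symm]
      exact ⟨_, (f ⟨x, hx⟩).2, rfl⟩
  let Φ : ↥(X \ Ext.fin '' G) ≃ ↥(X' \ Ext.fin '' G') :=
    Equiv.ofBijective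
      (fun a => ⟨F ⟨a, a.2.1⟩, (F ⟨a, a.2.1⟩).2, fun h => a.2.2 ((hFG _).1 h)⟩) (by
        constructor
        · intro a b hab
          have h0 := congrArg Subtype.val hab
          have h1 : F ⟨a, a.2.1⟩ = F ⟨b, b.2.1⟩ := Subtype.ext h0
          have h2 := congrArg Subtype.val (F.injective h1)
          exact Subtype.ext h2
        · intro b
          obtain ⟨p, hp⟩ := F.surjective ⟨b, b.2.1⟩
          refine ⟨⟨p, p.2, fun h => b.2.2 ?_⟩, ?_⟩
          · have := (hFG p).2 h
            rwa [hp] at this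
          · have h0 := congrArg Subtype.val hp
            exact Subtype.ext h0)
  have hfr : ∀ x, Ext.fin x ∈ X \ Ext.fin '' G ↔ x ∈ frontier G := fun x => by
    rw [Set.mem_sdiff, hX, hinj.mem_set_image, hG.frontier_eq, Set.mem_sdiff]
  have hfr' : ∀ x, Ext.fin x ∈ X' \ Ext.fin '' G' ↔ x ∈ frontier G' := fun x => by
    rw [Set.mem_sdiff, hX', hinj'.mem_set_image, hG'.frontier_eq, Set.mem_sdiff]
  refine ⟨_, _, Φ, hfr, hfr', fun a b hab y z hyz => ?_⟩
  have hne : ∀ (a : ↥(X \ Ext.fin '' G)) (y : G),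
      (⟨a, a.2.1⟩ : X) ≠ ⟨Ext.fin (y : E), hGX y⟩ := fun a y h =>
    a.2.2 ⟨y, y.2, (congrArg Subtype.val h).symm⟩
  have hne' : (⟨a, a.2.1⟩ : X) ≠ ⟨b, b.2.1⟩ := fun h => by
    have h0 := congrArg Subtype.val h
    exact hab (Subtype.ext h0)
  have := hqm ⟨a, a.2.1⟩ ⟨Ext.fin (y : E), hGX y⟩ ⟨Ext.fin (z : E), hGX z⟩ ⟨b, b.2.1⟩
    (hne a y) (hne a z) hne'
    (fun h => hyz (Subtype.ext (hinj (congrArg Subtype.val h)))) (hne b y).symm (hne b z).symm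
    (Or.inl ⟨a.2, b.2⟩)
  rwa [hF y ⟨Ext.fin (y : E), hGX y⟩ rfl, hF z ⟨Ext.fin (z : E), hGX z⟩ rfl] at this

theorem HasQMExtension.exists_isBoundaryQM {η : ℝ≥0 ≃ₜ ℝ≥0} {G : Set E} {G' : Set E'}
    {f : G ≃ₜ G'} (hG : IsOpen G) (hG' : IsOpen G') (h : HasQMExtension η f) :
    ∃ (A : Set (Ext E)) (A' : Set (Ext E')) (Φ : A ≃ A'), IsBoundaryQM η f Φ := by
  have hinj : Function.Injective (Ext.fin : E → Ext E) := Ext.isOpenEmbedding_fin.injective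
  have hinj' : Function.Injective (Ext.fin : E' → Ext E') := Ext.isOpenEmbedding_fin.injective
  rcases h with h | h
  · refine exists_isBoundaryQM_of_extends hG hG' (X := Ext.normClosure G)
      (X' := Ext.normClosure G') (fun x => hinj.mem_set_image) (fun x => hinj'.mem_set_image) ?_
    rwa [Ext.normClosure, ← image_sdiff hinj, ← hG.frontier_eq]
  · refine exists_isBoundaryQM_of_extends hG hG' (X := Ext.extClosure G)
      (X' := Ext.extClosure G') (fun x => ?_) (fun x => ?_) ?_
    · rw [Ext.isOpenEmbedding_fin.isInducing.closure_eq_preimage_closure_image]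
      rfl
    · rw [Ext.isOpenEmbedding_fin.isInducing.closure_eq_preimage_closure_image]
      rfl
    · rwa [Ext.extClosure, ← (Ext.isOpenEmbedding_fin.isOpenMap _ hG).frontier_eq]

end Extension

/-! ### Cross ratios of points whose images have bounded relative distance -/

section CrossRatioBound

variable {E : Type u} [NormedAddCommGroup E] {E' : Type v} [NormedAddCommGroup E']
  [NormedSpace ℝ E'] {η : ℝ≥0 ≃ₜ ℝ≥0} {G : Set E} {G' : Set E'} {f : G ≃ₜ G'}
  {A : Set (Ext E)} {A' : Set (Ext E')} {Φ : A ≃ A'}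

/-- Every boundary point of G' is at least as far from f y as d_{G'}(f y), so its distances to f y
and f z differ by a factor of at most 1 + t. Two boundary points give the square. -/
theorem IsBoundaryQM.crossRatio_bound_of_relDist_le (h : IsBoundaryQM η f Φ)
    (hG : IsOpen G) (hG' : IsProperDomain G') {t : ℝ} (ht : 0 ≤ t) {y z : G}
    (hr : relDist G' (f y) (f z) ≤ t) : ∀ a ∈ A, ∀ b ∈ A, extDist 1 a z * extDist 1 b y ≤
      lowerControl η ((1 + t) ^ 2) * (extDist 1 a y * extDist 1 b z) := by
  obtain ⟨h1, h2⟩ := hG'.dist_le_of_relDist_le (f y).2 (f z).2 hr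
  have hA : ∀ a : A', extDist 1 (a : Ext E') (f z) ≤ (1 + t) * extDist 1 (a : Ext E') (f y) ∧
      extDist 1 (a : Ext E') (f y) ≤ (1 + t) * extDist 1 (a : Ext E') (f z) := by
    rintro ⟨a, ha⟩
    cases a with
    | infty =>
      simp only [extDist_infty]
      constructor <;> linarith
    | fin a =>
      simp only [extDist_fin]
      have ha' := (h.mem_right a).1 ha
      have h3 := bdist_le_dist (x := (f y : E')) ha'
      have h4 := bdist_le_dist (x := (f z : E')) ha'
      rw [dist_comm] at h3 h4
      have h5 := dist_triangle a (f y) (f z)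
      have h6 := dist_triangle_right a (f y : E') (f z)
      constructor <;> nlinarith
  intro a ha b hb
  refine h.lower hG hG'.isOpen one_pos one_pos (a := ⟨a, ha⟩) (b := ⟨b, hb⟩) ?_
  have p1 := extDist_nonneg one_pos (Φ ⟨a, ha⟩ : Ext E') (f y : E')
  have p2 := extDist_nonneg one_pos (Φ ⟨b, hb⟩ : Ext E') (f y : E')
  calc
    _ ≤ ((1 + t) * extDist 1 (Φ ⟨a, ha⟩ : Ext E') (f y)) *
        ((1 + t) * extDist 1 (Φ ⟨b, hb⟩ : Ext E') (f z)) := by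
      gcongr
      exacts [(hA _).1, (hA _).2]
    _ = _ := by ring

end CrossRatioBound

/-! ### Bounded relative distance, or a boundary that looks like a point -/

section Dichotomy

variable {E : Type u} [NormedAddCommGroup E] [NormedSpace ℝ E]
  {E' : Type v} [NormedAddCommGroup E'] [NormedSpace ℝ E']

/-- If all cross ratios of two points with two boundary points are bounded, but the relative
distance of the points is large, then the whole boundary is near one of the points. -/
theorem boundary_near_of_relDist_large {G : Set E} (hG : IsProperDomain G) {A : Set (Ext E)}
    (hA : ∀ x, Ext.fin x ∈ A ↔ x ∈ frontier G) {y z : E} (hy : y ∈ G) {H : ℝ} (hH : 1 ≤ H)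
    (hcr : ∀ a ∈ A, ∀ b ∈ A, extDist 1 a z * extDist 1 b y ≤ H * (extDist 1 a y * extDist 1 b z))
    (hR : 8 * H * bdist G y < dist y z) :
    ∀ b ∈ A, ∃ b₀, b = Ext.fin b₀ ∧ dist b₀ y ≤ 8 * H * bdist G y := by
  have hd := hG.bdist_pos hy
  -- All boundary points are tested against one that almost realizes d_G(y); this also rules out ∞.
  obtain ⟨a, ha, hay⟩ := hG.exists_dist_le_mul hy (r := 2) (by norm_num)
  have haz : dist y z / 2 ≤ dist a z := by
    have := dist_triangle y a z
    nlinarith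
  have hmain : ∀ b ∈ A, dist y z * extDist 1 b y ≤ 4 * H * bdist G y * extDist 1 b z := by
    intro b hb
    have h1 := hcr _ ((hA a).2 ha) b hb
    rw [extDist_fin, extDist_fin, dist_comm a y] at h1
    have p1 := extDist_nonneg one_pos b y
    have p2 := extDist_nonneg one_pos b z
    have h2 : dist y z / 2 * extDist 1 b y ≤ dist a z * extDist 1 b y := by gcongr
    have h3 : H * (dist y a * extDist 1 b z) ≤ H * (2 * bdist G y * extDist 1 b z) := by gcongr
    linarith
  intro b hb
  have h1 := hmain b hb
  cases b with
  | infty =>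
    simp only [extDist_infty] at h1
    nlinarith
  | fin b =>
    refine ⟨b, rfl, ?_⟩
    simp only [extDist_fin] at h1
    have h2 := dist_triangle b y z
    have h3 : 4 * H * bdist G y * dist b z ≤ 4 * H * bdist G y * (dist b y + dist y z) := by
      gcongr
    have h4 : 4 * H * bdist G y * dist b y ≤ dist y z / 2 * dist b y := by
      gcongr
      linarith
    have hyz : 0 < dist y z := lt_trans (by positivity) hR
    have h5 : dist y z * dist b y ≤ dist y z * (8 * H * bdist G y) := by linarith
    exact le_of_mul_le_mul_left h5 hyz

variable {η : ℝ≥0 ≃ₜ ℝ≥0} {G : Set E} {G' : Set E'} {f : G ≃ₜ G'}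
  {A : Set (Ext E)} {A' : Set (Ext E')} {Φ : A ≃ A'}

theorem exists_mem_near_boundary (hG : IsProperDomain G) {z : E} (hz : z ∈ G) {δ : ℝ}
    (hδ : 0 < δ) (hδ1 : δ ≤ 1) : ∃ b ∈ frontier G, ∃ w ∈ G, dist z b ≤ 2 * bdist G z ∧
      dist w b = δ * dist z b ∧ dist w z ≤ bdist G z ∧
      qhEDist G z w ≤ ENNReal.ofReal (2 / δ) := by
  have hd := hG.bdist_pos hz
  -- As (1 - δ)(1 + δ/2) ≤ 1 - δ/2, the segment from z to w keeps distance (δ/2) d_G(z) from the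
  -- boundary.
  obtain ⟨b, hb, hzb⟩ := hG.exists_dist_le_mul hz (r := 1 + δ / 2) (by linarith)
  set w := AffineMap.lineMap b z δ with hw
  have hwb : dist w b = δ * dist z b := by
    rw [hw, dist_lineMap_left, Real.norm_eq_abs, abs_of_pos hδ, dist_comm b]
  have hwz : dist w z ≤ (1 - δ / 2) * bdist G z := by
    rw [hw, dist_lineMap_right, Real.norm_eq_abs, abs_of_nonneg (by linarith), dist_comm b]
    have := mul_le_mul_of_nonneg_left hzb (sub_nonneg.2 hδ1)
    nlinarith [mul_nonneg (mul_nonneg hδ.le hδ.le) hd.le]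
  have hwz' : dist w z < bdist G z := by nlinarith
  have hwG : w ∈ G := hG.ball_subset hz hwz'
  refine ⟨b, hb, w, hwG, by nlinarith, hwb, hwz'.le, ?_⟩
  obtain ⟨c, hc, hcs⟩ := IsCurve.exists_segment z w
  have hball : ∀ p ∈ segment ℝ z w, dist p z ≤ (1 - δ / 2) * bdist G z := fun p hp =>
    (convex_closedBall z ((1 - δ / 2) * bdist G z)).segment_subset
      (mem_closedBall_self (by nlinarith)) hwz hp
  refine (hc.qhEDist_le (G := G) (fun s hs => hG.ball_subset hz ?_) (m := δ / 2 * bdist G z)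
    (fun s hs => ?_) (by positivity)).trans ?_
  · have := hball _ (hcs hs)
    rw [mem_ball]
    nlinarith
  · have h1 := hball _ (hcs hs)
    have h2 := bdist_le_add (G := G) z (c s)
    rw [dist_comm] at h2
    linarith
  · refine ENNReal.ofReal_le_ofReal ?_
    rw [div_le_div_iff₀ (by positivity) hδ, dist_comm z w]
    nlinarith

/-- A point f w very close to b is reached from f z at quasihyperbolic cost 2/δ, so w is still far
from ∂G. From z and w the points of ∂G look alike, hence the image cross ratios are bounded by
`upperControl η 4`; as |f w - b| is tiny, any other boundary point must also be near f w. -/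
theorem frontier_near_of_boundary_near (h : IsBoundaryQM η f Φ) {M C : ℝ} (hM : 1 ≤ M)
    (hC : 0 ≤ C) (hf : IsCQH M C f) (hG : IsProperDomain G) (hG' : IsProperDomain G')
    {δ : ℝ} (hδ : 0 < δ) (hδU : δ * (4 * upperControl η 4 + 2) ≤ 1) {y z : G} {r : ℝ} (hr : 0 < r)
    (hA : ∀ b ∈ A, ∃ b₀, b = Ext.fin b₀ ∧ dist b₀ (y : E) ≤ r)
    (hyz : r + 3 * r * Real.exp (M * (2 / δ) + C + 1) ≤ dist (y : E) z) :
    ∃ b ∈ frontier G', dist (f z : E') b ≤ 2 * bdist G' (f z) ∧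
      ∀ a ∈ frontier G', dist a b ≤ δ * (4 * upperControl η 4 + 2) * bdist G' (f z) := by
  have hU := one_le_upperControl η 4
  set U := upperControl η 4
  have hδ1 : δ ≤ 1 := by nlinarith
  obtain ⟨b, hb, w', hw', hzb, hwb, hwz, hk⟩ := exists_mem_near_boundary hG' (f z).2 hδ hδ1
  obtain ⟨w, hw⟩ := f.surjective ⟨w', hw'⟩
  have hw0 : (f w : E') = w' := by rw [hw]
  rw [← hw0] at hwb hwz hk
  set K := M * (2 / δ) + C with hK
  have hK0 : 0 ≤ K := by positivity
  have hkzw : qhEDist G z w < ENNReal.ofReal (K + 1) := by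
    refine lt_of_le_of_lt ((qhEDist_le_ofReal_iff hG z.2 w.2 hK0).2 ?_)
      ((ENNReal.ofReal_lt_ofReal_iff (by linarith)).2 (lt_add_one K))
    have h1 := (qhEDist_le_ofReal_iff hG' (f z).2 (f w).2 (by positivity)).1 hk
    have h2 := (hf z w).1
    rw [div_le_iff₀ (by linarith)] at h2
    have h3 : qhDist G' (f z) (f w) * M ≤ M * (2 / δ) := by
      rw [mul_comm M]
      gcongr
    exact (sub_le_iff_le_add.1 h2).trans (add_le_add_left h3 C)
  obtain ⟨c, l, hc, -, -, hfar⟩ := exists_isCurve_of_qhEDist_lt hG hkzw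
  have hzw := hfar l ⟨hc.nonneg, le_rfl⟩
  rw [hc.target] at hzw
  have hexp : 1 ≤ Real.exp (K + 1) := Real.one_le_exp (by linarith)
  have hfr : ∀ a ∈ frontier G, dist a (y : E) ≤ r := fun a ha => by
    obtain ⟨a₀, h1, h2⟩ := hA _ ((h.mem_left a).2 ha)
    cases h1
    exact h2
  have hdz : 3 * r * Real.exp (K + 1) ≤ bdist G z := hG.le_bdist fun a ha => by
    have h1 := dist_triangle_left (y : E) z a
    have h2 := hfr a ha
    rw [dist_comm a z] at *
    linarith
  have hdw : 3 * r ≤ bdist G w := by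
    have : Real.exp (K + 1) * (3 * r) ≤ Real.exp (K + 1) * bdist G w := by linarith
    exact le_of_mul_le_mul_left this (by positivity)
  have hdz' : 3 * r ≤ bdist G z := le_trans (by nlinarith) hdz
  -- The boundary has diameter at most 2r, so at distance 3r or more its points agree up to a factor
  -- 2; used at z and at w, this gives the cross ratio bound 4.
  have hcomp : ∀ {p : E}, 3 * r ≤ bdist G p → ∀ a ∈ frontier G, ∀ b ∈ frontier G,
      dist a p ≤ 2 * dist b p := fun {p} hp a ha b hb => by
    have h1 := bdist_le_dist (x := p) hb
    have h2 := dist_triangle a b p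
    have h3 := dist_triangle_right a b (y : E)
    have h4 := hfr a ha
    have h5 := hfr b hb
    rw [dist_comm] at h1
    linarith
  refine ⟨b, hb, hzb, fun a ha => ?_⟩
  have hup : dist a (f w : E') * dist b (f z : E') ≤
      U * (dist a (f z : E') * dist b (f w : E')) := by
    have h1 := h.upper hG.isOpen hG'.isOpen (N := 1) (N' := 1) one_pos one_pos (T := 4)
      (a := Φ.symm ⟨_, (h.mem_right a).2 ha⟩) (b := Φ.symm ⟨_, (h.mem_right b).2 hb⟩)
      (y := z) (z := w) ?_
    · simpa only [Φ.apply_symm_apply, extDist_fin] using h1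
    · generalize Φ.symm ⟨_, (h.mem_right a).2 ha⟩ = a₁
      generalize Φ.symm ⟨_, (h.mem_right b).2 hb⟩ = b₁
      obtain ⟨a₁, ha₁⟩ := a₁
      obtain ⟨b₁, hb₁⟩ := b₁
      obtain ⟨a₀, rfl, -⟩ := hA a₁ ha₁
      obtain ⟨b₀, rfl, -⟩ := hA b₁ hb₁
      rw [h.mem_left] at ha₁ hb₁
      simp only [extDist_fin]
      have h1 := hcomp hdw a₀ ha₁ b₀ hb₁
      have h2 := hcomp hdz' b₀ hb₁ a₀ ha₁
      calc
        _ ≤ (2 * dist b₀ (w : E)) * (2 * dist a₀ (z : E)) := by gcongr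
        _ = _ := by ring
  have hz0 : 0 < dist b (f z : E') := by
    have := hG'.bdist_pos (f z).2
    rw [dist_comm]
    exact this.trans_le (bdist_le_dist hb)
  rw [dist_comm b (f w : E'), hwb, dist_comm (f z : E') b] at hup
  have hup2 : dist a (f w : E') ≤ U * δ * dist a (f z : E') := by
    refine le_of_mul_le_mul_right ?_ hz0
    linarith
  have h1 := dist_triangle a (f w : E') (f z)
  have h2 := dist_triangle a (f w : E') b
  rw [hwb] at h2
  have h3 : δ * U ≤ 1 / 4 := by nlinarith
  have h4 : δ * dist (f z : E') b ≤ δ * (2 * bdist G' (f z)) := by gcongr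
  have hUδ : U * δ * dist a (f z : E') ≤ U * δ * (dist a (f w : E') + bdist G' (f z)) := by
    gcongr
    linarith
  have h5 : δ * U * dist a (f w : E') ≤ 1 / 4 * dist a (f w : E') := by gcongr
  have h6 : 0 ≤ δ * U * bdist G' (f z) := by
    have := bdist_nonneg (G := G') (f z : E')
    positivity
  nlinarith

end Dichotomy

/-- Either the relative distance of two points is bounded by a control of the relative distance of
their images, or the boundary of `G'` looks like a point from one of the images. -/
theorem exists_relDist_le_or_frontier_near (η : ℝ≥0 ≃ₜ ℝ≥0) {M C t θ : ℝ} (hM : 1 ≤ M)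
    (hC : 0 ≤ C) (ht : 0 ≤ t) (hθ : 0 < θ) : ∃ R : ℝ, 0 ≤ R ∧
      ∀ {E : Type u} [NormedAddCommGroup E] [NormedSpace ℝ E]
        {E' : Type v} [NormedAddCommGroup E'] [NormedSpace ℝ E'] {G : Set E} {G' : Set E'}
        {f : G ≃ₜ G'}, IsProperDomain G → IsProperDomain G' → IsCQH M C f →
        HasQMExtension η f → ∀ y z : G, relDist G' (f y) (f z) ≤ t → relDist G y z ≤ R ∨
          ∃ p : G', (p = f y ∨ p = f z) ∧ ∃ b ∈ frontier G', dist (p : E') b ≤ 2 * bdist G' p ∧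
            ∀ a ∈ frontier G', dist a b ≤ θ * bdist G' p := by
  have hU := one_le_upperControl η 4
  set U := upperControl η 4 with hU'
  set H := lowerControl η ((1 + t) ^ 2) with hH'
  have hH : 1 ≤ H := one_le_lowerControl η _
  set δ := min θ 1 / (4 * U + 2) with hδ'
  have hδ : 0 < δ := by positivity
  have hδU : δ * (4 * U + 2) = min θ 1 := by
    rw [hδ']
    field_simp
  obtain ⟨X, hX⟩ : ∃ X, X = Real.exp (M * (2 / δ) + C + 1) := ⟨_, rfl⟩
  have hexp : 0 < X := hX ▸ Real.exp_pos _
  -- With r = 8H d_G(y), the two summands are what r and 3rX need in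
  -- `frontier_near_of_boundary_near`.
  set R := 8 * H + 24 * H * X with hR'
  refine ⟨R, by positivity, ?_⟩
  intro E _ _ E' _ _ G G' f hG hG' hf hext
  obtain ⟨A, A', Φ, h⟩ := hext.exists_isBoundaryQM hG.isOpen hG'.isOpen
  have key : ∀ y z : G, relDist G' (f y) (f z) ≤ t → bdist G y ≤ bdist G z → R < relDist G y z →
      ∃ b ∈ frontier G', dist (f z : E') b ≤ 2 * bdist G' (f z) ∧
        ∀ a ∈ frontier G', dist a b ≤ θ * bdist G' (f z) := by
    intro y z hr hyz hlt
    have hd := hG.bdist_pos y.2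
    rw [relDist, min_eq_left hyz, lt_div_iff₀ hd] at hlt
    have h0 : 0 < 24 * H * X * bdist G y := by positivity
    have hA := boundary_near_of_relDist_large hG h.mem_left y.2 hH
      (h.crossRatio_bound_of_relDist_le hG.isOpen hG' ht hr) (by rw [hR'] at hlt; linarith)
    obtain ⟨b, hb, hzb, hb'⟩ := frontier_near_of_boundary_near h hM hC hf hG hG' hδ
      (hδU.trans_le (min_le_right _ _)) (r := 8 * H * bdist G y) (by positivity) hA
      (by rw [← hX]; rw [hR'] at hlt; linarith)
    refine ⟨b, hb, hzb, fun a ha => (hb' a ha).trans ?_⟩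
    rw [hδU]
    exact mul_le_mul_of_nonneg_right (min_le_left _ _) (bdist_nonneg _)
  intro y z hr
  rcases le_or_gt (relDist G y z) R with h1 | h1
  · exact Or.inl h1
  refine Or.inr ?_
  rcases le_total (bdist G y) (bdist G z) with h2 | h2
  · exact ⟨f z, Or.inr rfl, key y z hr h2 h1⟩
  · refine ⟨f y, Or.inl rfl, key z y ?_ h2 ?_⟩
    · rwa [relDist, dist_comm, min_comm] at hr
    · rwa [relDist, dist_comm, min_comm] at h1

/-! ### Naturality of the image -/

section Natural

theorem relDist_le_relDiam {E : Type u} [NormedAddCommGroup E] {G A : Set E} {x y : E}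
    (hx : x ∈ A) (hy : y ∈ A) : ENNReal.ofReal (relDist G x y) ≤ relDiam G A :=
  (le_iSup₂ (f := fun y (_ : y ∈ A) => ENNReal.ofReal (relDist G x y)) y hy).trans
    (le_iSup₂ (f := fun x (_ : x ∈ A) => ⨆ y ∈ A, ENNReal.ofReal (relDist G x y)) x hx)

theorem qhEDist_le_qhDiam {E : Type u} [NormedAddCommGroup E] [NormedSpace ℝ E] {G A : Set E}
    {x y : E} (hx : x ∈ A) (hy : y ∈ A) : qhEDist G x y ≤ qhDiam G A :=
  (le_iSup₂ (f := fun y (_ : y ∈ A) => qhEDist G x y) y hy).trans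
    (le_iSup₂ (f := fun x (_ : x ∈ A) => ⨆ y ∈ A, qhEDist G x y) x hx)

/-- Points at relative distance at most t from p keep distance m = d_G(p)/(1 + t) from the boundary.
The factor 1/(16(1 + t)) places ∂G within m/16 of b, so one can go around b. -/
theorem IsProperDomain.qhEDist_le_of_frontier_near {E : Type u} [NormedAddCommGroup E]
    [NormedSpace ℝ E] {G : Set E} (hE : 2 ≤ Module.rank ℝ E)
    (hG : IsProperDomain G) {p b x y : E} {t : ℝ} (ht : 0 ≤ t) (hp : p ∈ G) (hx : x ∈ G)
    (hy : y ∈ G) (hb : b ∈ frontier G) (hpb : dist p b ≤ 2 * bdist G p)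
    (hfr : ∀ a ∈ frontier G, dist a b ≤ 1 / (16 * (1 + t)) * bdist G p)
    (hxp : relDist G x p ≤ t) (hyp : relDist G y p ≤ t) :
    qhEDist G x y ≤ ENNReal.ofReal (64 * (t + 2) * (1 + t)) := by
  have hd := hG.bdist_pos hp
  set m := bdist G p / (1 + t) with hm
  have hm0 : 0 < m := by positivity
  have key : ∀ x ∈ G, relDist G x p ≤ t → m ≤ dist x b ∧ dist x b ≤ (t + 2) * bdist G p := by
    intro x hx hxp
    obtain ⟨h1, h2⟩ := hG.dist_le_of_relDist_le hx hp hxp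
    have h3 := bdist_le_add (G := G) p x
    rw [dist_comm] at h3
    refine ⟨le_trans ?_ (bdist_le_dist hb), ?_⟩
    · rw [hm, div_le_iff₀ (by linarith)]
      linarith
    · have := dist_triangle x p b
      linarith
  obtain ⟨hx1, hx2⟩ := key x hx hxp
  obtain ⟨hy1, hy2⟩ := key y hy hyp
  refine (qhEDist_le_of_frontier_subset hE hG hm0 (fun a ha => (hfr a ha).trans_eq ?_) hx hx1
    hy1).trans (ENNReal.ofReal_le_ofReal ?_)
  · rw [hm]
    field_simp
  · rw [hm, div_div_eq_mul_div, div_le_iff₀ hd]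
    have : dist x b + dist y b ≤ 2 * (t + 2) * bdist G p := by linarith
    calc
      _ ≤ 32 * (2 * (t + 2) * bdist G p) * (1 + t) := by gcongr
      _ = _ := by ring

theorem qhEDist_le_of_isCQH {E : Type u} [NormedAddCommGroup E] [NormedSpace ℝ E]
    {E' : Type v} [NormedAddCommGroup E'] [NormedSpace ℝ E'] {G : Set E} {G' : Set E'}
    {f : G ≃ₜ G'} {M C : ℝ} (hM : 1 ≤ M) (hC : 0 ≤ C) (hG : IsProperDomain G)
    (hG' : IsProperDomain G') (hf : IsCQH M C f) {x y : G} {K : ℝ} (hK : 0 ≤ K)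
    (h : qhEDist G x y ≤ ENNReal.ofReal K) :
    qhEDist G' (f x) (f y) ≤ ENNReal.ofReal (M * K + C) := by
  rw [qhEDist_le_ofReal_iff hG x.2 y.2 hK] at h
  rw [qhEDist_le_ofReal_iff hG' (f x).2 (f y).2 (by positivity)]
  exact (hf x y).2.trans (by gcongr)

theorem exists_qhDiam_bound (ψ : ℝ≥0 → ℝ≥0) (η : ℝ≥0 ≃ₜ ℝ≥0) {M C : ℝ} (hψ : Monotone ψ)
    (hM : 1 ≤ M) (hC : 0 ≤ C) (t : ℝ≥0) : ∃ B : ℝ≥0,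
      ∀ {E : Type u} [NormedAddCommGroup E] [NormedSpace ℝ E]
        {E' : Type v} [NormedAddCommGroup E'] [NormedSpace ℝ E'] {G : Set E} {G' : Set E'}
        {f : G ≃ₜ G'}, 2 ≤ Module.rank ℝ E' → IsProperDomain G → IsProperDomain G' →
        IsCQH M C f → HasQMExtension η f → IsNatural ψ G →
        ∀ A : Set E', A ⊆ G' → IsConnected A → relDiam G' A ≤ t → qhDiam G' A ≤ B := by
  obtain ⟨R, hR0, hR⟩ := exists_relDist_le_or_frontier_near.{u, v} η (t := t)
    (θ := 1 / (16 * (1 + t))) hM hC t.2 (by positivity)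
  refine ⟨(max (M * ψ R.toNNReal + C) (64 * (t + 2) * (1 + t))).toNNReal, ?_⟩
  intro E _ _ E' _ _ G G' f hE' hG hG' hf hext hnat A' hA'G hA' hdiam
  have hrel : ∀ x ∈ A', ∀ y ∈ A', relDist G' x y ≤ t := fun x hx y hy => by
    have h1 : ENNReal.ofReal (relDist G' x y) ≤ t :=
      (relDist_le_relDiam hx hy).trans hdiam
    rw [← ENNReal.ofReal_coe_nnreal] at h1
    exact (ENNReal.ofReal_le_ofReal_iff t.2).1 h1
  refine iSup₂_le fun x hx => iSup₂_le fun y hy => ?_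
  change _ ≤ ENNReal.ofReal (max _ _)
  set S : Set G' := Subtype.val ⁻¹' A' with hS
  set A : Set E := (fun x : G' => (f.symm x : E)) '' S with hA
  by_cases hcase : ∀ x ∈ S, ∀ y ∈ S, relDist G (f.symm x) (f.symm y) ≤ R
  -- Connectedness is passed to the preimage because naturality of G concerns connected sets only.
  · have hSconn : IsConnected S := by
      refine ⟨⟨⟨x, hA'G hx⟩, hx⟩, ?_⟩
      rw [← Topology.IsInducing.subtypeVal.isPreconnected_image, hS,
        Subtype.image_preimage_val, inter_eq_self_of_subset_right hA'G]
      exact hA'.isPreconnected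
    have hAconn : IsConnected A :=
      hSconn.image _ (continuous_subtype_val.comp f.symm.continuous).continuousOn
    have hAG : A ⊆ G := by
      rintro _ ⟨p, -, rfl⟩
      exact (f.symm p).2
    have hAdiam : relDiam G A ≤ ENNReal.ofReal R := by
      refine iSup₂_le ?_
      rintro _ ⟨p, hp, rfl⟩
      refine iSup₂_le ?_
      rintro _ ⟨q, hq, rfl⟩
      exact ENNReal.ofReal_le_ofReal (hcase p hp q hq)
    have h1 := hnat A hAG hAconn (hAdiam.trans_lt ENNReal.ofReal_lt_top).ne
    have h2 : qhEDist G (f.symm ⟨x, hA'G hx⟩) (f.symm ⟨y, hA'G hy⟩) ≤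
        ENNReal.ofReal (ψ R.toNNReal : ℝ) := by
      rw [ENNReal.ofReal_coe_nnreal]
      refine le_trans ?_ (h1.trans (ENNReal.coe_le_coe.2 (hψ ?_)))
      · exact qhEDist_le_qhDiam ⟨_, hx, rfl⟩ ⟨_, hy, rfl⟩
      · exact ENNReal.toNNReal_mono ENNReal.ofReal_ne_top hAdiam
    have h3 := qhEDist_le_of_isCQH hM hC hG hG' hf (NNReal.coe_nonneg _) h2
    simp only [f.apply_symm_apply] at h3
    exact h3.trans (ENNReal.ofReal_le_ofReal (le_max_left _ _))
  · push Not at hcase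
    obtain ⟨p, hp, q, hq, hpq⟩ := hcase
    have h1 := hR hG hG' hf hext (f.symm p) (f.symm q)
      (by simpa only [f.apply_symm_apply] using hrel p hp q hq)
    rcases h1 with h1 | ⟨r, hr, b, hb, hrb, hfr⟩
    · exact absurd h1 (not_le.2 hpq)
    simp only [f.apply_symm_apply] at hr
    have hrA : (r : E') ∈ A' := by
      rcases hr with rfl | rfl
      exacts [hp, hq]
    exact (hG'.qhEDist_le_of_frontier_near hE' t.2 r.2 (hA'G hx) (hA'G hy) hb hrb hfr
      (hrel x hx r hrA) (hrel y hy r hrA)).trans (ENNReal.ofReal_le_ofReal (le_max_right _ _))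

theorem exists_isNatural (ψ : ℝ≥0 → ℝ≥0) (η : ℝ≥0 ≃ₜ ℝ≥0) {M C : ℝ} (hψ : Monotone ψ)
    (hM : 1 ≤ M) (hC : 0 ≤ C) : ∃ ψ' : ℝ≥0 → ℝ≥0, Monotone ψ' ∧
      ∀ {E : Type u} [NormedAddCommGroup E] [NormedSpace ℝ E]
        {E' : Type v} [NormedAddCommGroup E'] [NormedSpace ℝ E'] {G : Set E} {G' : Set E'}
        {f : G ≃ₜ G'}, 2 ≤ Module.rank ℝ E' → IsProperDomain G → IsProperDomain G' →
        IsCQH M C f → HasQMExtension η f → IsNatural ψ G → IsNatural ψ' G' := by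
  choose B hB using fun n : ℕ => exists_qhDiam_bound.{u, v} ψ η hψ hM hC (n : ℝ≥0)
  -- The bounds B n need not increase with n; their partial sums do.
  refine ⟨fun t => ∑ i ∈ Finset.range (⌈t⌉₊ + 1), B i, fun s t hst => ?_, ?_⟩
  · exact Finset.sum_le_sum_of_subset
      (Finset.range_subset_range.2 (Nat.add_le_add_right (Nat.ceil_mono hst) 1))
  · intro E _ _ E' _ _ G G' f hE' hG hG' hf hext hnat A hAG hA htop
    have h1 : relDiam G' A ≤ ((⌈(relDiam G' A).toNNReal⌉₊ : ℝ≥0) : ℝ≥0∞) := by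
      rw [← ENNReal.coe_toNNReal htop, ENNReal.coe_le_coe, ENNReal.toNNReal_coe]
      exact Nat.le_ceil _
    refine (hB _ hE' hG hG' hf hext hnat A hAG hA h1).trans (ENNReal.coe_le_coe.2 ?_)
    exact Finset.single_le_sum (f := B) (fun _ _ => zero_le)
      (Finset.mem_range.2 (Nat.lt_succ_self _))

end Natural

/-! ### Central points for a pair of boundary points -/

section Plump

/-- Juxtaposed letters stand for distances. If s = |ay|, then |aw| is comparable to |ay| and |bw| to
|by|; if s = |ab|, then |aw| is comparable to |bw| and |ay| to |by|. -/
theorem cross_bounds_of_central {c s aw bw ay b_y ab : ℝ} (hc : 1 ≤ c) (hs : 0 < s)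
    (hcase : s = ay ∨ s = ab) (hsa : s ≤ ay) (hsb : s ≤ ab) (hle : ay ≤ b_y)
    (haw : aw ≤ s) (haw' : s ≤ 4 * c * aw) (hbw' : s ≤ 4 * c * bw)
    (h1 : b_y ≤ ay + ab) (h2 : bw ≤ aw + ab) (h3 : ab ≤ ay + b_y) (h4 : b_y ≤ ay + aw + bw) :
    aw * b_y ≤ 12 * c * (ay * bw) ∧ ay * bw ≤ 12 * c * (aw * b_y) := by
  have haw0 : 0 < aw := by
    by_contra h
    nlinarith
  have hbw0 : 0 < bw := by
    by_contra h
    nlinarith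
  have hb0 : 0 < b_y := by linarith
  rcases hcase with rfl | rfl
  · constructor
    · have h5 : b_y ≤ 12 * c * bw := by nlinarith
      calc
        aw * b_y ≤ s * (12 * c * bw) := by gcongr
        _ = _ := by ring
    · have h5 : bw ≤ 3 * b_y := by linarith
      calc
        s * bw ≤ (4 * c * aw) * (3 * b_y) := by gcongr
        _ = _ := by ring
  · constructor
    · have h5 : b_y ≤ 2 * ay := by linarith
      calc
        aw * b_y ≤ (4 * c * bw) * (2 * ay) := by
          gcongr
          linarith
        _ = 8 * c * (ay * bw) := by ring
        _ ≤ _ := by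
          have : 0 ≤ c * (ay * bw) := by
            have : 0 ≤ ay := by linarith
            positivity
          linarith
    · have h5 : bw ≤ 2 * (4 * c * aw) := by linarith
      calc
        ay * bw ≤ b_y * (2 * (4 * c * aw)) := by
          have : 0 ≤ ay := by linarith
          gcongr
        _ = 8 * c * (aw * b_y) := by ring
        _ ≤ _ := by
          have : 0 ≤ c * (aw * b_y) := by positivity
          linarith

theorem le_of_small_cross {c ε aw ay we ye : ℝ} (hc : 1 ≤ c) (hε : 0 < ε) (hcε : c * ε ≤ 1 / 64)
    (hay : 0 ≤ ay) (haw : 0 ≤ aw) (hwe : 0 < we) (hawe : aw ≤ 8 * c * we)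
    (hye : ye ≤ ay + aw + we) (h : we * ay ≤ ε * (ye * aw)) : ay ≤ 18 * (c * ε) * aw := by
  have h1 : we * ay ≤ ε * ((ay + aw + we) * aw) := h.trans (by gcongr)
  have h2 : ε * (ay * aw) ≤ ε * (ay * (8 * c * we)) := by gcongr
  have h3 : ε * (aw * aw) ≤ ε * (8 * c * we * aw) := by gcongr
  have h4 : we * ay ≤ we * (8 * (c * ε) * ay + (8 * (c * ε) + ε) * aw) := by linarith
  have h5 := le_of_mul_le_mul_left h4 hwe
  have h6 : ε * aw ≤ c * ε * aw := by
    gcongr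
    nlinarith
  have h7 : c * ε * ay ≤ 1 / 64 * ay := by gcongr
  nlinarith

/-- The smallness at a puts y very near a. If s = |ab|, the smallness at b puts y very near b too.
If s = |ay₁|, comparing y with y₁ makes |by| small relative to |by₁| ≤ 2|ab|. Either way |ay| + |by|
< |ab|. -/
theorem not_small_cross {c ε T s aw bw ay₁ by₁ ay b_y ab we ye : ℝ} (hc : 1 ≤ c) (hT : 1 ≤ T)
    (hε : 0 < ε) (hcε : c * ε * T ≤ 1 / 64) (hs : 0 < s) (hcase : s = ay₁ ∨ s = ab)
    (hsb : s ≤ ab) (haw0 : 0 ≤ aw) (hbw0 : 0 ≤ bw) (hay : 0 ≤ ay) (hby : 0 ≤ b_y)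
    (haw : aw ≤ s) (hwe : s ≤ 4 * c * we)
    (h1 : by₁ ≤ ay₁ + ab) (h2 : bw ≤ aw + ab) (h3 : ab ≤ ay + b_y)
    (hyea : ye ≤ ay + aw + we) (hyeb : ye ≤ b_y + bw + we)
    (hj : ay₁ * b_y ≤ T * (ay * by₁))
    (ha : we * ay ≤ ε * (ye * aw)) (hb : we * b_y ≤ ε * (ye * bw)) : False := by
  have hcε0 : 0 < c * ε := by positivity
  have hcε' : c * ε ≤ 1 / 64 := by nlinarith
  have hwe0 : 0 < we := by
    by_contra h
    nlinarith
  have ka := le_of_small_cross hc hε hcε' hay haw0 hwe0 (by linarith) hyea ha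
  have ka' : ay ≤ 18 * (c * ε) * s := ka.trans (by gcongr)
  rcases hcase with rfl | rfl
  · have h5 : s * b_y ≤ s * (18 * (c * ε * T) * by₁) := by
      rcases le_or_gt 0 by₁ with hb1 | hb1
      · calc
          _ ≤ T * (ay * by₁) := hj
          _ ≤ T * (18 * (c * ε) * s * by₁) := by gcongr
          _ = _ := by ring
      · exfalso
        have : T * (ay * by₁) ≤ 0 :=
          mul_nonpos_of_nonneg_of_nonpos (by linarith) (mul_nonpos_of_nonneg_of_nonpos hay hb1.le)
        have h6 : s * b_y ≤ 0 := hj.trans this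
        have h7 : b_y ≤ 0 := by
          by_contra h
          nlinarith
        nlinarith
    have h6 := le_of_mul_le_mul_left h5 hs
    have h7 : 18 * (c * ε * T) * by₁ ≤ 18 * (c * ε * T) * (2 * ab) := by
      gcongr
      linarith
    have hab : 0 ≤ ab := hs.le.trans hsb
    have h8 : c * ε * T * ab ≤ 1 / 64 * ab := by gcongr
    have h9 : c * ε * s ≤ 1 / 64 * s := by gcongr
    nlinarith
  · have kb := le_of_small_cross hc hε hcε' hby hbw0 hwe0 (by linarith) hyeb hb
    have h5 : c * ε * bw ≤ c * ε * (2 * s) := by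
      gcongr
      linarith
    have h9 : c * ε * s ≤ 1 / 64 * s := by gcongr
    nlinarith

/-- Near boundary points of `G`, at all scales that do not exceed the distance to a point of `G`,
there are points far from the boundary. -/
def IsBoundaryPlump {E : Type u} [NormedAddCommGroup E] (c : ℝ) (G : Set E) : Prop :=
  ∀ a ∈ frontier G, ∀ y ∈ G, ∀ s, 0 < s → s ≤ dist a y →
    ∃ w ∈ G, dist a w ≤ s ∧ s ≤ 4 * c * bdist G w

variable {E : Type u} [NormedAddCommGroup E] {G : Set E}

theorem IsBoundaryPlump.exists_central_of_fin {c : ℝ} (hp : IsBoundaryPlump c G) (hc : 1 ≤ c)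
    (hG : IsOpen G) {A : Set (Ext E)} (hA : ∀ x, Ext.fin x ∈ A ↔ x ∈ frontier G) {a : E}
    (ha : a ∈ frontier G) {b : Ext E} (hb : b ∈ A) (hab : b ≠ Ext.fin a) {y₁ y₂ : E} (hy₁ : y₁ ∈ G)
    {N T ε : ℝ} (hN : 0 < N) (hNa : dist a y₁ + dist a y₂ ≤ N)
    (hle : dist a y₁ ≤ extDist N b y₁) (hT : 1 ≤ T) (hε : 0 < ε) (hcε : c * ε * T ≤ 1 / 64)
    (hj : dist a y₁ * extDist N b y₂ ≤ T * (dist a y₂ * extDist N b y₁)) :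
    ∃ w ∈ G, dist a w * extDist N b y₁ ≤ 12 * c * (dist a y₁ * extDist N b w) ∧
      dist a y₁ * extDist N b w ≤ 12 * c * (dist a w * extDist N b y₁) ∧
      ∀ e ∈ A, ∀ y, y = y₁ ∨ y = y₂ → extDist N e w * dist a y ≤ ε * (extDist N e y * dist a w) →
        extDist N e w * extDist N b y ≤ ε * (extDist N e y * extDist N b w) → False := by
  have hab0 : 0 < extDist N b a := extDist_pos hN hab
  have hay0 : 0 < dist a y₁ := dist_pos.2 fun h => by
    rw [h, hG.frontier_eq] at ha
    exact ha.2 hy₁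
  -- At this scale w, taken near a and far from the boundary, is neither closer to a or b than y₁
  -- allows nor beyond b.
  set s := min (dist a y₁) (extDist N b a) with hs
  have hs0 : 0 < s := lt_min hay0 hab0
  have hcase : s = dist a y₁ ∨ s = extDist N b a := by
    rcases min_choice (dist a y₁) (extDist N b a) with h | h
    exacts [Or.inl h, Or.inr h]
  have hsa : s ≤ dist a y₁ := min_le_left _ _
  have hsb : s ≤ extDist N b a := min_le_right _ _
  obtain ⟨w, hw, haw, hdw⟩ := hp a ha y₁ hy₁ s hs0 hsa
  have hfar : ∀ e ∈ A, s ≤ 4 * c * extDist N e w := by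
    intro e he
    cases e with
    | infty =>
      rw [extDist_infty]
      have := dist_nonneg (x := a) (y := y₂)
      nlinarith
    | fin e =>
      rw [extDist_fin]
      refine hdw.trans ?_
      rw [dist_comm]
      gcongr
      exact bdist_le_dist ((hA e).1 he)
  have haw' := hfar _ ((hA a).2 ha)
  have hbw' := hfar b hb
  rw [extDist_fin] at haw'
  have t1 : ∀ y, extDist N b y ≤ dist a y + extDist N b a := fun y => by
    cases b with
    | infty => simp [extDist_infty]
    | fin b =>
      rw [extDist_fin, extDist_fin]
      linarith [dist_triangle b a y]
  have t2 : ∀ y, extDist N b a ≤ dist a y + extDist N b y := fun y => by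
    cases b with
    | infty => simp [extDist_infty]
    | fin b =>
      rw [extDist_fin, extDist_fin]
      linarith [dist_triangle_right b a y]
  obtain ⟨c1, c2⟩ := cross_bounds_of_central hc hs0 hcase hsa hsb hle haw haw' hbw' (t1 y₁) (t1 w)
    (t2 y₁) (by linarith [t1 y₁, t2 w])
  refine ⟨w, hw, c1, c2, fun e he y hy h1 h2 => ?_⟩
  have hyw : dist a y + dist a w ≤ 2 * N := by
    have := dist_nonneg (x := a) (y := y₂)
    have := dist_nonneg (x := a) (y := y₁)
    rcases hy with rfl | rfl <;> linarith
  refine not_small_cross hc hT hε hcε hs0 hcase hsb dist_nonneg (extDist_nonneg hN b w)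
    dist_nonneg (extDist_nonneg hN b y) haw (hfar e he) (t1 y₁) (t1 w) (t2 y) ?_ ?_ ?_ h1 h2
  · cases e with
    | infty => simp [extDist_infty]; positivity
    | fin e =>
      rw [extDist_fin, extDist_fin]
      linarith [dist_triangle e w y, dist_triangle_left w y a]
  · cases e with
    | infty =>
      rw [extDist_infty, extDist_infty]
      linarith [extDist_nonneg hN b y, extDist_nonneg hN b w]
    | fin e =>
      rw [extDist_fin, extDist_fin]
      have h3 := dist_triangle e w y
      suffices dist w y ≤ extDist N b y + extDist N b w by linarith
      cases b with
      | infty =>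
        rw [extDist_infty, extDist_infty]
        linarith [dist_triangle_left w y a]
      | fin b =>
        rw [extDist_fin, extDist_fin]
        linarith [dist_triangle_left w y b]
  · rcases hy with rfl | rfl
    · exact le_mul_of_one_le_left (mul_nonneg dist_nonneg (extDist_nonneg hN b y)) hT
    · exact hj

theorem IsBoundaryPlump.exists_central {c : ℝ} (hp : IsBoundaryPlump c G) (hc : 1 ≤ c)
    (hG : IsOpen G) {A : Set (Ext E)} (hA : ∀ x, Ext.fin x ∈ A ↔ x ∈ frontier G) {a b : Ext E}
    (ha : a ∈ A) (hb : b ∈ A) (hab : a ≠ b) {y₁ y₂ : E} (hy₁ : y₁ ∈ G) {T ε : ℝ} (hT : 1 ≤ T)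
    (hε : 0 < ε) (hcε : c * ε * T ≤ 1 / 64)
    (hj : ∀ N, 0 < N → extDist N a y₁ * extDist N b y₂ ≤ T * (extDist N a y₂ * extDist N b y₁) ∧
      extDist N b y₁ * extDist N a y₂ ≤ T * (extDist N b y₂ * extDist N a y₁)) :
    ∃ N, 0 < N ∧ ∃ w ∈ G,
      extDist N a w * extDist N b y₁ ≤ 12 * c * (extDist N a y₁ * extDist N b w) ∧
      extDist N a y₁ * extDist N b w ≤ 12 * c * (extDist N a w * extDist N b y₁) ∧
      ∀ e ∈ A, ∀ y, y = y₁ ∨ y = y₂ →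
        extDist N e w * extDist N a y ≤ ε * (extDist N e y * extDist N a w) →
        extDist N e w * extDist N b y ≤ ε * (extDist N e y * extDist N b w) → False := by
  have h0 : ∀ (a : Ext E) y, 0 ≤ extDist 0 a y := fun a y => by
    cases a with
    | infty => exact le_rfl
    | fin a => exact dist_nonneg
  -- N exceeds all finite distances involved, as `extDist 0` counts ∞ as 0. Hence whichever of a, b
  -- is closer to y₁ is finite.
  set N := 1 + (extDist 0 a y₁ + extDist 0 a y₂) + (extDist 0 b y₁ + extDist 0 b y₂) with hN
  have a1 := h0 a y₁
  have a2 := h0 a y₂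
  have b1 := h0 b y₁
  have b2 := h0 b y₂
  have hN0 : 0 < N := by positivity
  refine ⟨N, hN0, ?_⟩
  rcases le_total (extDist N a y₁) (extDist N b y₁) with hle | hle
  · cases a with
    | infty =>
      cases b with
      | infty => exact absurd rfl hab
      | fin b =>
        exfalso
        rw [extDist_infty, extDist_fin] at hle
        simp only [extDist_fin] at b1 b2 hN
        linarith
    | fin a =>
      simp only [extDist_fin] at hN a1 a2 hle hj ⊢
      exact hp.exists_central_of_fin hc hG hA ((hA a).1 ha) hb hab.symm hy₁ hN0 (by linarith) hle hT
        hε hcε (hj N hN0).1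
  · cases b with
    | infty =>
      cases a with
      | infty => exact absurd rfl hab
      | fin a =>
        exfalso
        rw [extDist_infty, extDist_fin] at hle
        simp only [extDist_fin] at a1 a2 hN
        linarith
    | fin b =>
      simp only [extDist_fin] at hN b1 b2 hle hj ⊢
      obtain ⟨w, hw, h1, h2, h3⟩ := hp.exists_central_of_fin hc hG hA ((hA b).1 hb) ha hab hy₁ hN0
        (by linarith) hle hT hε hcε (hj N hN0).2
      exact ⟨w, hw, by linarith, by linarith, fun e he y hy ha' hb' => h3 e he y hy hb' ha'⟩

end Plump

/-! ### What uniformity gives: plumpness and quasihyperbolic bounds -/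

section UniformConsequences

theorem dist_le_of_eVariationOn_le {E : Type u} [NormedAddCommGroup E] {γ : ℝ → E} {s t a b K : ℝ} (hs : s ∈ Icc a b)
    (ht : t ∈ Icc a b) (hK : 0 ≤ K) (h : eVariationOn γ (Icc a b) ≤ ENNReal.ofReal K) :
    dist (γ s) (γ t) ≤ K := by
  have h1 := (eVariationOn.edist_le γ hs ht).trans h
  rw [edist_dist] at h1
  exact (ENNReal.ofReal_le_ofReal_iff hK).1 h1

/-- On an arc from a point p of G very near a to y, the point at distance s/4 from p is at least
that far from both ends, so the cigar condition applies. -/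
theorem IsUniform.isBoundaryPlump {E : Type u} [NormedAddCommGroup E] {G : Set E} {c : ℝ}
    (h : IsUniform c G) (hc : 1 ≤ c) : IsBoundaryPlump c G := by
  intro a ha y hy s hs hsy
  obtain ⟨p, hp, hap⟩ := mem_closure_iff.1 (frontier_subset_closure ha) (s / 8) (by positivity)
  have hpy : s - s / 8 ≤ dist p y := by linarith [dist_triangle a p y]
  have hne : p ≠ y := dist_pos.1 (by linarith)
  obtain ⟨γ, hcont, -, hmaps, h0, h1, -, hcig⟩ := h p hp y hy hne
  have hcont' : ContinuousOn (fun t => dist p (γ t)) (Icc 0 1) := (continuous_const.dist continuous_id).comp_continuousOn hcont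
  obtain ⟨t, ht, hdt⟩ : s / 4 ∈ (fun t => dist p (γ t)) '' Icc 0 1 := by
    refine intermediate_value_Icc zero_le_one hcont' ⟨?_, ?_⟩
    · simp only [h0, dist_self]
      positivity
    · simp only [h1]
      linarith
  simp only at hdt
  refine ⟨γ t, hmaps ht, by linarith [dist_triangle a p (γ t)], ?_⟩
  have hK : 0 ≤ c * bdist G (γ t) := mul_nonneg (by linarith) (bdist_nonneg _)
  rcases min_le_iff.1 (hcig t ht) with hv | hv
  · have := dist_le_of_eVariationOn_le (left_mem_Icc.2 ht.1) (right_mem_Icc.2 ht.1) hK hv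
    rw [h0] at this
    linarith
  · have := dist_le_of_eVariationOn_le (left_mem_Icc.2 ht.2) (right_mem_Icc.2 ht.2) hK hv
    rw [h1] at this
    linarith [dist_triangle p (γ t) y]

variable {E : Type u} [NormedAddCommGroup E] [NormedSpace ℝ E] {G : Set E} {c : ℝ}

theorem IsUniform.qhEDist_le (h : IsUniform c G) (hc : 1 ≤ c) (hG : IsProperDomain G) {x y : E}
    (hx : x ∈ G) (hy : y ∈ G) {t : ℝ} (ht : relDist G x y ≤ t) :
    qhEDist G x y ≤ ENNReal.ofReal (c * (1 + c) * t) := by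
  have hdx := hG.bdist_pos hx
  have hdy := hG.bdist_pos hy
  rcases eq_or_ne x y with rfl | hne
  · refine ((IsCurve.const x).qhEDist_le (fun _ _ => hx) (m := bdist G x) (fun _ _ => le_rfl)
      hdx).trans ?_
    simp
  obtain ⟨γ, hcont, -, hmaps, h0, h1, hlen, hcig⟩ := h x hx y hy hne
  have hrect : IsRectCurve G x y γ :=
    ⟨hcont, hmaps, h0, h1, (hlen.trans_lt ENNReal.ofReal_lt_top).ne⟩
  have hm : 0 < min (bdist G x) (bdist G y) := lt_min hdx hdy
  refine (hrect.qhEDist_le (m := min (bdist G x) (bdist G y) / (1 + c)) (fun t ht => ?_)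
    (by positivity) hlen).trans (ENNReal.ofReal_le_ofReal ?_)
  · rw [div_le_iff₀ (by linarith)]
    have hK : 0 ≤ c * bdist G (γ t) := mul_nonneg (by linarith) (bdist_nonneg _)
    rcases min_le_iff.1 (hcig t ht) with hv | hv
    · refine (min_le_left _ _).trans ?_
      have h2 := dist_le_of_eVariationOn_le (left_mem_Icc.2 ht.1) (right_mem_Icc.2 ht.1) hK hv
      rw [h0] at h2
      linarith [bdist_le_add (G := G) x (γ t)]
    · refine (min_le_right _ _).trans ?_
      have h2 := dist_le_of_eVariationOn_le (right_mem_Icc.2 ht.2) (left_mem_Icc.2 ht.2) hK hv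
      rw [h1] at h2
      linarith [bdist_le_add (G := G) y (γ t)]
  · rw [div_div_eq_mul_div]
    calc
      _ = c * (1 + c) * relDist G x y := by rw [relDist]; ring
      _ ≤ _ := by gcongr

end UniformConsequences

/-! ### Quasihyperbolic bounds and plumpness of the image -/

section Image

theorem exists_qhEDist_bound (η : ℝ≥0 ≃ₜ ℝ≥0) {c M C t : ℝ} (hc : 1 ≤ c) (hM : 1 ≤ M) (hC : 0 ≤ C)
    (ht : 0 ≤ t) : ∃ K : ℝ, 0 ≤ K ∧
      ∀ {E : Type u} [NormedAddCommGroup E] [NormedSpace ℝ E]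
        {E' : Type v} [NormedAddCommGroup E'] [NormedSpace ℝ E'] {G : Set E} {G' : Set E'}
        {f : G ≃ₜ G'}, 2 ≤ Module.rank ℝ E' → IsProperDomain G → IsProperDomain G' →
        IsCQH M C f → HasQMExtension η f → IsUniform c G →
        ∀ x ∈ G', ∀ y ∈ G', relDist G' x y ≤ t → qhEDist G' x y ≤ ENNReal.ofReal K := by
  obtain ⟨R, hR0, hR⟩ := exists_relDist_le_or_frontier_near.{u, v} η (t := t)
    (θ := 1 / (16 * (1 + t))) hM hC ht (by positivity)
  refine ⟨max (M * (c * (1 + c) * R) + C) (64 * (t + 2) * (1 + t)),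
    le_max_of_le_right (by positivity), ?_⟩
  intro E _ _ E' _ _ G G' f hE' hG hG' hf hext hunif x hx y hy hxy
  obtain ⟨p, hp⟩ := f.surjective ⟨x, hx⟩
  obtain ⟨q, hq⟩ := f.surjective ⟨y, hy⟩
  have hxp : (f p : E') = x := by rw [hp]
  have hyq : (f q : E') = y := by rw [hq]
  subst hxp hyq
  have hself : ∀ z : E', relDist G' z z ≤ t := fun z => by simpa [relDist] using ht
  have hyx : relDist G' (f q) (f p) ≤ t := by rwa [relDist, dist_comm, min_comm]
  rcases hR hG hG' hf hext p q hxy with h | ⟨r, hr, b, hb, hrb, hfr⟩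
  · exact (qhEDist_le_of_isCQH hM hC hG hG' hf (by positivity)
      (hunif.qhEDist_le hc hG p.2 q.2 h)).trans (ENNReal.ofReal_le_ofReal (le_max_left _ _))
  · refine (hG'.qhEDist_le_of_frontier_near hE' ht r.2 hx hy hb hrb hfr ?_ ?_).trans
      (ENNReal.ofReal_le_ofReal (le_max_right _ _))
    · rcases hr with rfl | rfl
      exacts [hself _, hxy]
    · rcases hr with rfl | rfl
      exacts [hyx, hself _]

/-- Points of `G` are near points that are far from the boundary, at all scales that do not exceed
the distance to another point of `G`. -/
def IsPlump {E : Type u} [NormedAddCommGroup E] (c : ℝ) (G : Set E) : Prop :=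
  ∀ x ∈ G, ∀ y ∈ G, ∀ s, 0 < s → s ≤ dist x y → ∃ w ∈ G, dist x w ≤ s ∧ s ≤ c * bdist G w

section

variable {E : Type u} [NormedAddCommGroup E] {E' : Type v} [NormedAddCommGroup E']
  {η : ℝ≥0 ≃ₜ ℝ≥0} {G : Set E} {G' : Set E'} {f : G ≃ₜ G'}
  {A : Set (Ext E)} {A' : Set (Ext E')} {Φ : A ≃ A'}

/-- The image of a central point of the preimages of a and b works: the bound 12c on its cross
ratios fixes its distance to a up to constants. A boundary point e too near it would make cross
ratios with a and with b small, in the image and hence in G, against the choice of the central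
point. -/
theorem IsBoundaryQM.exists_far_point [NormedSpace ℝ E'] (h : IsBoundaryQM η f Φ) {c T ε U V : ℝ}
    (hc : 1 ≤ c) (hG : IsOpen G) (hG' : IsProperDomain G') (hp : IsBoundaryPlump c G)
    (hTdef : T = lowerControl η 12) (hεdef : ε = 1 / (64 * c * T))
    (hUdef : U = upperControl η (12 * c)) (hVdef : V = upperControl η ε⁻¹)
    {a b : E'} (ha : a ∈ frontier G') (hb : b ∈ frontier G')
    {y₁ y₂ : G} {σ : ℝ} (hσ : 0 < σ) (hy₁ : dist a (f y₁) = σ) (hy₂ : dist a (f y₂) = σ / 4)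
    (hab : 8 * U * σ ≤ dist a b) :
    ∃ w ∈ G', dist a w ≤ 3 * U * σ ∧ σ ≤ 24 * U * V * bdist G' w := by
  have hT : 1 ≤ T := hTdef ▸ one_le_lowerControl η _
  have hU : 1 ≤ U := hUdef ▸ one_le_upperControl η _
  have hV : 1 ≤ V := hVdef ▸ one_le_upperControl η _
  have hε : 0 < ε := by rw [hεdef]; positivity
  have hcε : c * ε * T ≤ 1 / 64 := by
    rw [hεdef]
    apply le_of_eq
    field_simp
  set D := dist a b with hD
  have hDσ : 8 * σ ≤ D := le_trans (by nlinarith) hab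
  have hD0 : 0 < D := by linarith
  have hbnd : ∀ p : E', dist a p ≤ 3 / 8 * D → 5 / 8 * D ≤ dist b p ∧ dist b p ≤ 11 / 8 * D := by
    intro p hp
    have h1 := dist_triangle_right a b p
    have h2 := dist_triangle_left b p a
    constructor <;> linarith
  obtain ⟨l1, u1⟩ := hbnd (f y₁) (by linarith)
  obtain ⟨l2, u2⟩ := hbnd (f y₂) (by linarith)
  obtain ⟨a₁, ha₁⟩ := Φ.surjective ⟨_, (h.mem_right a).2 ha⟩
  obtain ⟨b₁, hb₁⟩ := Φ.surjective ⟨_, (h.mem_right b).2 hb⟩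
  have ea : ∀ p : E', extDist 1 (Φ a₁ : Ext E') p = dist a p := fun p => by rw [ha₁, extDist_fin]
  have eb : ∀ p : E', extDist 1 (Φ b₁ : Ext E') p = dist b p := fun p => by rw [hb₁, extDist_fin]
  have hne : (a₁ : Ext E) ≠ b₁ := fun heq => by
    have h1 : a₁ = b₁ := Subtype.ext heq
    rw [← h1, ha₁] at hb₁
    have h2 : a = b := by simpa using hb₁
    rw [hD, h2, dist_self] at hD0
    exact hD0.false
  obtain ⟨N, hN, w, hw, hw1, hw2, hcontra⟩ := hp.exists_central hc hG h.mem_left a₁.2 b₁.2 hne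
    y₁.2 (y₂ := y₂) hT hε hcε (fun N hN => by
      constructor
      · rw [mul_comm (extDist N (a₁ : Ext E) y₂)]
        have := h.lower hG hG'.isOpen hN one_pos (T := 12) (a := a₁) (b := b₁) (y := y₂) (z := y₁) ?_
        · rw [hTdef]
          linarith
        · rw [ea, ea, eb, eb, hy₁, hy₂]
          nlinarith
      · rw [mul_comm (extDist N (b₁ : Ext E) y₂)]
        have := h.lower hG hG'.isOpen hN one_pos (T := 12) (a := b₁) (b := a₁) (y := y₂) (z := y₁) ?_
        · rw [hTdef]
          linarith
        · rw [ea, ea, eb, eb, hy₁, hy₂]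
          nlinarith)
  lift w to G using hw
  have k1 := h.upper hG hG'.isOpen hN one_pos (T := 12 * c) (a := a₁) (b := b₁) (y := y₁) (z := w)
    hw1
  have k2 := h.upper hG hG'.isOpen hN one_pos (T := 12 * c) (a := a₁) (b := b₁) (y := w) (z := y₁)
    hw2
  rw [ea, ea, eb, eb, hy₁, ← hUdef] at k1 k2
  have hwa : dist a (f w : E') ≤ 3 * U * σ := by
    have h1 : dist b (f w : E') ≤ dist a (f w : E') + D := by
      linarith [dist_triangle_left b (f w : E') a]
    have h2 : dist a (f w : E') * (5 / 8 * D) ≤ dist a (f w : E') * dist b (f y₁ : E') := by gcongr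
    have h3 : U * (σ * dist b (f w : E')) ≤ U * (σ * (dist a (f w : E') + D)) := by gcongr
    have h4 : 8 * U * σ * dist a (f w : E') ≤ D * dist a (f w : E') := by gcongr
    have h5 : D * dist a (f w : E') ≤ D * (3 * U * σ) := by
      have : 0 ≤ D * (U * σ) := by positivity
      nlinarith
    exact le_of_mul_le_mul_left h5 hD0
  obtain ⟨lw, uw⟩ := hbnd (f w) (by linarith)
  have hwa' : σ ≤ 3 * U * dist a (f w : E') := by
    have h1 : σ * (5 / 8 * D) ≤ σ * dist b (f w : E') := by gcongr
    have h2 : U * (dist a (f w : E') * dist b (f y₁ : E')) ≤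
        U * (dist a (f w : E') * (11 / 8 * D)) := by gcongr
    have h3 : D * σ ≤ D * (3 * U * dist a (f w : E')) := by
      have : 0 ≤ U * (dist a (f w : E') * D) := by positivity
      nlinarith
    exact le_of_mul_le_mul_left h3 hD0
  refine ⟨f w, (f w).2, hwa, ?_⟩
  by_contra! hlt
  obtain ⟨e, he, hwe⟩ := hG'.exists_dist_lt (x := (f w : E')) (r := σ / (24 * U * V)) (by
    rw [lt_div_iff₀ (by positivity)]
    linarith)
  rw [lt_div_iff₀ (by positivity), dist_comm] at hwe
  have hwe' : dist e (f w : E') * (24 * (U * V)) ≤ σ := by linarith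
  -- Two reference points are needed since e may be near one of them; their images are at least 3σ/4
  -- apart.
  obtain ⟨y, hy, hye, hay⟩ : ∃ y : G, ((y : E) = y₁ ∨ (y : E) = y₂) ∧ σ / 4 ≤ dist e (f y : E') ∧
      dist a (f y : E') ≤ σ := by
    rcases le_or_gt (σ / 4) (dist e (f y₁ : E')) with h1 | h1
    · exact ⟨y₁, Or.inl rfl, h1, hy₁.le⟩
    · refine ⟨y₂, Or.inr rfl, ?_, by linarith⟩
      have h2 := dist_triangle a (f y₂ : E') (f y₁)
      have h3 := dist_triangle_left (f y₂ : E') (f y₁) e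
      linarith
  obtain ⟨-, uy⟩ := hbnd (f y) (by linarith)
  obtain ⟨e₁, he₁⟩ := Φ.surjective ⟨_, (h.mem_right e).2 he⟩
  have ee : ∀ p : E', extDist 1 (Φ e₁ : Ext E') p = dist e p := fun p => by rw [he₁, extDist_fin]
  have hsmall : upperControl η ε⁻¹ * (1 / (2 * V)) < 1 := by
    rw [← hVdef]
    field_simp
    norm_num
  have hσV : 0 ≤ dist e (f w : E') := dist_nonneg
  refine hcontra e₁ e₁.2 y hy ?_ ?_
  · refine h.small hG hG'.isOpen hN one_pos hε hsmall ?_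
    rw [ea, ea, ee, ee, ← mul_div_right_comm, one_mul, le_div_iff₀ (by positivity)]
    calc
      dist e (f w : E') * dist a (f y : E') * (2 * V) ≤ dist e (f w : E') * σ * (2 * V) := by gcongr
      _ ≤ dist e (f w : E') * (3 * U * dist a (f w : E')) * (2 * V) := by gcongr
      _ = dist e (f w : E') * (24 * (U * V)) / 4 * dist a (f w : E') := by ring
      _ ≤ σ / 4 * dist a (f w : E') := by gcongr
      _ ≤ _ := by gcongr
  · refine h.small hG hG'.isOpen hN one_pos hε hsmall ?_
    rw [eb, eb, ee, ee, ← mul_div_right_comm, one_mul, le_div_iff₀ (by positivity)]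
    calc
      dist e (f w : E') * dist b (f y : E') * (2 * V)
          ≤ dist e (f w : E') * (11 / 8 * D) * (2 * V) := by gcongr
      _ = dist e (f w : E') * (1 * V) * (11 / 4 * D) := by ring
      _ ≤ dist e (f w : E') * (U * V) * (11 / 4 * D) := by gcongr
      _ = dist e (f w : E') * (24 * (U * V)) * (11 / 96 * D) := by ring
      _ ≤ σ * (11 / 96 * D) := by gcongr
      _ ≤ σ / 4 * (5 / 8 * D) := by
        have : 0 ≤ σ * D := by positivity
        linarith
      _ ≤ _ := by gcongr

end

theorem exists_isPlump (η : ℝ≥0 ≃ₜ ℝ≥0) {c : ℝ} (hc : 1 ≤ c) : ∃ P : ℝ, 1 ≤ P ∧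
      ∀ {E : Type u} [NormedAddCommGroup E] [NormedSpace ℝ E]
        {E' : Type v} [NormedAddCommGroup E'] [NormedSpace ℝ E'] {G : Set E} {G' : Set E'}
        {f : G ≃ₜ G'}, IsProperDomain G → IsProperDomain G' → HasQMExtension η f →
        IsBoundaryPlump c G → IsPlump P G' := by
  obtain ⟨T, hT⟩ : ∃ T, T = lowerControl η 12 := ⟨_, rfl⟩
  obtain ⟨ε, hε⟩ : ∃ ε, ε = 1 / (64 * c * T) := ⟨_, rfl⟩
  obtain ⟨U, hU⟩ : ∃ U, U = upperControl η (12 * c) := ⟨_, rfl⟩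
  obtain ⟨V, hV⟩ : ∃ V, V = upperControl η ε⁻¹ := ⟨_, rfl⟩
  have hU1 : 1 ≤ U := hU ▸ one_le_upperControl η _
  have hV1 : 1 ≤ V := hV ▸ one_le_upperControl η _
  have hUV : 1 ≤ U * V := one_le_mul_of_one_le_of_one_le hU1 hV1
  have hUUV : 1 ≤ U * (U * V) := one_le_mul_of_one_le_of_one_le hU1 hUV
  refine ⟨384 * (U * (U * V)), by linarith, ?_⟩
  intro E _ _ E' _ _ G G' f hG hG' hext hp x hx y hy ρ hρ hρxy
  obtain ⟨A, A', Φ, h⟩ := hext.exists_isBoundaryQM hG.isOpen hG'.isOpen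
  -- Then 8Uσ = ρ/2, the separation of a and b needed below, and 3Uσ stays well under ρ.
  set σ := ρ / (16 * U) with hσ
  have hσ0 : 0 < σ := by positivity
  have hσU : 16 * U * σ = ρ := by
    rw [hσ]
    field_simp
  have hσρ : 16 * σ ≤ ρ := by nlinarith
  rcases le_or_gt (σ / 8) (bdist G' x) with hdx | hdx
  · refine ⟨x, hx, by rw [dist_self]; exact hρ.le, ?_⟩
    have h1 : U * (σ / 8) ≤ U * bdist G' x := by gcongr
    have h2 : 1 * (U * bdist G' x) ≤ (U * V) * (U * bdist G' x) := by
      have := bdist_nonneg (G := G') x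
      gcongr
    linarith
  obtain ⟨a, ha, hxa⟩ := hG'.exists_dist_le_mul hx (r := 2) (by norm_num)
  have hya : ρ - σ / 4 ≤ dist a y := by
    linarith [dist_triangle x a y]
  by_cases hfar : ∃ b ∈ frontier G', ρ / 2 ≤ dist a b
  · obtain ⟨b, hb, hab⟩ := hfar
    have hivt : ∀ r, dist a x ≤ r → r ≤ dist a y → ∃ p : G, dist a (f p : E') = r := by
      intro r h1 h2
      obtain ⟨q, hq, hqr⟩ := hG'.isConnected.isPreconnected.intermediate_value hx hy
        (f := fun p => dist a p) (by fun_prop) ⟨h1, h2⟩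
      exact ⟨f.symm ⟨q, hq⟩, by rw [f.apply_symm_apply]; exact hqr⟩
    rw [dist_comm] at hxa
    obtain ⟨y₁, hy₁⟩ := hivt σ (by linarith) (by linarith)
    obtain ⟨y₂, hy₂⟩ := hivt (σ / 4) (by linarith) (by linarith)
    obtain ⟨w, hw, haw, hdw⟩ := h.exists_far_point hc hG.isOpen hG' hp hT hε hU hV ha hb hσ0 hy₁
      hy₂ (by linarith)
    refine ⟨w, hw, ?_, ?_⟩
    · linarith [dist_triangle_left x w a]
    · have : U * σ ≤ U * (24 * U * V * bdist G' w) := by gcongr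
      linarith
  · push Not at hfar
    -- Here ∂G' lies within ρ/2 of a, so the segment from a to y is in G' from distance 3ρ/4
    -- onwards, and its point there is ρ/4 away from the boundary.
    set τ := 3 / 4 * ρ / dist a y with hτ
    have hay : 0 < dist a y := by linarith
    have hτ1 : τ ≤ 1 := by
      rw [hτ, div_le_one hay]
      linarith
    have hτ0 : 0 ≤ τ := by positivity
    have hτy : τ * dist a y = 3 / 4 * ρ := by
      rw [hτ]
      field_simp
    have hd : ∀ r, 0 ≤ r → dist (AffineMap.lineMap a y r) a = r * dist a y := fun r hr => by
      rw [dist_lineMap_left, Real.norm_eq_abs, abs_of_nonneg hr]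
    have hsub : (AffineMap.lineMap a y : ℝ → E') '' Icc τ 1 ⊆ G' := by
      refine subset_of_disjoint_frontier hG'.isOpen (isPreconnected_Icc.image _
        AffineMap.lineMap_continuous.continuousOn) ?_ ⟨1, right_mem_Icc.2 hτ1, rfl⟩ ?_
      · rintro _ ⟨r, hr, rfl⟩ hfr
        have h1 := hfar _ hfr
        rw [dist_comm, hd r (hτ0.trans hr.1)] at h1
        have h2 : τ * dist a y ≤ r * dist a y := by
          gcongr
          exact hr.1
        linarith
      · rwa [AffineMap.lineMap_apply_one]
    have hdw := hd τ hτ0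
    refine ⟨AffineMap.lineMap a y τ, hsub ⟨τ, left_mem_Icc.2 hτ1, rfl⟩, ?_, ?_⟩
    · have := dist_triangle_right x (AffineMap.lineMap a y τ) a
      linarith
    · have h1 : ρ / 4 ≤ bdist G' (AffineMap.lineMap a y τ) := hG'.le_bdist fun b hb => by
        have h2 := dist_triangle_right (AffineMap.lineMap a y τ) a b
        have h3 := hfar b hb
        linarith
      have h2 : 1 * bdist G' (AffineMap.lineMap a y τ) ≤
          U * (U * V) * bdist G' (AffineMap.lineMap a y τ) := by
        have := bdist_nonneg (G := G') (AffineMap.lineMap a y τ)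
        gcongr
      linarith

end Image

/-! ### From curves to arcs -/

section Arcs

variable {E : Type u} [NormedAddCommGroup E]

/-- The infimum of the lengths of the curves from `x` to `y` in a compact set is attained. -/
theorem exists_shortest_curve {Γ : Set E} (hΓ : IsCompact Γ) {c : ℝ → E} {l : ℝ} {x y : E}
    (hxy : x ≠ y) (hc : IsCurve c l x y) (hcΓ : MapsTo c (Icc 0 l) Γ) :
    ∃ σ m, IsCurve σ m x y ∧ MapsTo σ (Icc 0 m) Γ ∧
      ∀ σ' m', IsCurve σ' m' x y → MapsTo σ' (Icc 0 m') Γ → m ≤ m' := by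
  set S : Set ℝ := {m | ∃ σ, IsCurve σ m x y ∧ MapsTo σ (Icc 0 m) Γ} with hS
  have hSd : ∀ m ∈ S, dist x y ≤ m := by
    rintro m ⟨σ, hσ, -⟩
    have := hσ.dist_le_sub le_rfl hσ.nonneg le_rfl
    rwa [hσ.source, hσ.target, sub_zero] at this
  have hlS : l ∈ S := ⟨c, hc, hcΓ⟩
  have hxy0 : 0 < dist x y := dist_pos.2 hxy
  -- Closed sets in the compact product of copies of Γ, increasing with m. By compactness they have
  -- a common element, whose Lipschitz constant on [0,1] is the infimum.
  let T : ℝ → Set (ℝ → E) := fun m => {g | (∀ t, g t ∈ Γ) ∧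
    (∀ s t, s ∈ Icc (0 : ℝ) 1 → t ∈ Icc (0 : ℝ) 1 → dist (g s) (g t) ≤ m * |s - t|) ∧
    g 0 = x ∧ g 1 = y}
  have hTclosed : ∀ m, IsClosed (T m) := by
    intro m
    have e1 : IsClosed {g : ℝ → E | ∀ t, g t ∈ Γ} := by
      simp only [Set.ofPred_forall]
      exact isClosed_iInter fun t => hΓ.isClosed.preimage (continuous_apply t)
    have e2 : IsClosed {g : ℝ → E | ∀ s t, s ∈ Icc (0 : ℝ) 1 → t ∈ Icc (0 : ℝ) 1 →
        dist (g s) (g t) ≤ m * |s - t|} := by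
      simp only [Set.ofPred_forall]
      exact isClosed_iInter fun s => isClosed_iInter fun t => isClosed_iInter fun _ =>
        isClosed_iInter fun _ =>
          isClosed_le ((continuous_apply s).dist (continuous_apply t)) continuous_const
    have e3 : IsClosed {g : ℝ → E | g 0 = x} := isClosed_eq (continuous_apply 0) continuous_const
    have e4 : IsClosed {g : ℝ → E | g 1 = y} := isClosed_eq (continuous_apply 1) continuous_const
    exact e1.inter (e2.inter (e3.inter e4))
  have hTcompact : ∀ m, IsCompact (T m) := fun m =>
    (isCompact_univ_pi fun _ : ℝ => hΓ).of_isClosed_subset (hTclosed m) fun g hg t _ => hg.1 t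
  have hTne : ∀ m ∈ S, (T m).Nonempty := by
    rintro m ⟨σ, hσ, hσΓ⟩
    have hmem : ∀ t, m * (projIcc (0 : ℝ) 1 zero_le_one t : ℝ) ∈ Icc 0 m := fun t =>
      ⟨mul_nonneg hσ.nonneg (projIcc _ _ _ t).2.1,
        mul_le_of_le_one_right hσ.nonneg (projIcc _ _ _ t).2.2⟩
    refine ⟨fun t => σ (m * (projIcc (0 : ℝ) 1 zero_le_one t : ℝ)), fun t => hσΓ (hmem t),
      fun s t hs ht => ?_, ?_, ?_⟩
    · refine (hσ.dist_le (hmem s) (hmem t)).trans_eq ?_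
      rw [← mul_sub, abs_mul, abs_of_nonneg hσ.nonneg, projIcc_of_mem _ hs, projIcc_of_mem _ ht]
    · simp [hσ.source]
    · simp [hσ.target]
  have hTmono : ∀ m m', m ≤ m' → T m ⊆ T m' := fun m m' h g hg =>
    ⟨hg.1, fun s t hs ht => (hg.2.1 s t hs ht).trans (by gcongr), hg.2.2⟩
  have : Nonempty S := ⟨⟨l, hlS⟩⟩
  obtain ⟨g, hg⟩ := IsCompact.nonempty_iInter_of_directed_nonempty_isCompact_isClosed
    (fun m : S => T m) (fun m m' => by
      rcases le_total (m : ℝ) m' with h | h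
      · exact ⟨m, subset_rfl, hTmono _ _ h⟩
      · exact ⟨m', hTmono _ _ h, subset_rfl⟩)
    (fun m => hTne m m.2) (fun m => hTcompact m) (fun m => hTclosed m)
  rw [mem_iInter] at hg
  have hbdd : BddBelow S := ⟨dist x y, hSd⟩
  set m := sInf S with hm
  have hm0 : 0 < m := hxy0.trans_le (le_csInf ⟨l, hlS⟩ hSd)
  obtain ⟨hgΓ, -, hg0, hg1⟩ := hg ⟨l, hlS⟩
  have hglip : ∀ s t, s ∈ Icc (0 : ℝ) 1 → t ∈ Icc (0 : ℝ) 1 → s < t →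
      dist (g s) (g t) ≤ m * (t - s) := by
    intro s t hs ht hst
    rw [← div_le_iff₀ (sub_pos.2 hst)]
    refine le_csInf ⟨l, hlS⟩ fun b hb => ?_
    rw [div_le_iff₀ (sub_pos.2 hst)]
    have := (hg ⟨b, hb⟩).2.1 s t hs ht
    rwa [abs_sub_comm, abs_of_pos (sub_pos.2 hst)] at this
  refine ⟨fun t => g (t / m), m, IsCurve.of_dist_le hm0.le (fun s t hs hst ht => ?_) (by simp [hg0])
    (by simp [hg1, hm0.ne']), fun t _ => hgΓ _, fun σ' m' h1 h2 => csInf_le hbdd ⟨σ', h1, h2⟩⟩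
  rcases hst.eq_or_lt with rfl | hst'
  · simp
  · refine (hglip _ _ ⟨by positivity, (div_le_one hm0).2 (hst.trans ht)⟩
      ⟨div_nonneg (hs.trans hst) hm0.le, (div_le_one hm0).2 ht⟩
      (div_lt_div_of_pos_right hst' hm0)).trans_eq ?_
    field_simp

/-- A curve contains an arc with the same endpoints, whose parts are not longer than the
corresponding parts of the curve. -/
theorem IsCurve.exists_arc {c : ℝ → E} {l : ℝ} {x y : E} (hc : IsCurve c l x y) (hxy : x ≠ y) :
    ∃ σ m, IsCurve σ m x y ∧ 0 < m ∧ m ≤ l ∧ InjOn σ (Icc 0 m) ∧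
      ∀ s ∈ Icc 0 m, ∃ τ ∈ Icc 0 l, σ s = c τ ∧ s ≤ τ ∧ m - s ≤ l - τ := by
  have hcΓ : MapsTo c (Icc 0 l) (c '' Icc 0 l) := mapsTo_image _ _
  obtain ⟨σ, m, hσ, hσΓ, hmin⟩ := exists_shortest_curve
    (isCompact_Icc.image_of_continuousOn hc.lip.continuousOn) hxy hc hcΓ
  have hm0 : 0 < m := by
    refine hσ.nonneg.lt_of_ne fun h => hxy ?_
    rw [← hσ.source, ← hσ.target, ← h]
  have hi : ∀ {c' : ℝ → E} {l' s : ℝ}, MapsTo c' (Icc 0 l') (c '' Icc 0 l) → s ∈ Icc 0 l' →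
      MapsTo c' (Icc 0 s) (c '' Icc 0 l) := fun h hs => h.mono_left (Icc_subset_Icc_right hs.2)
  have hf : ∀ {c' : ℝ → E} {l' s : ℝ}, MapsTo c' (Icc 0 l') (c '' Icc 0 l) → s ∈ Icc 0 l' →
      MapsTo (fun t => c' (s + t)) (Icc 0 (l' - s)) (c '' Icc 0 l) := fun h hs t ht =>
    h ⟨by linarith [ht.1, hs.1], by linarith [ht.2]⟩
  refine ⟨σ, m, hσ, hm0, hmin c l hc hcΓ, ?_, ?_⟩
  -- Cutting out a loop would give a shorter curve.
  · have hne : ∀ s ∈ Icc 0 m, ∀ t ∈ Icc 0 m, s < t → σ s ≠ σ t := by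
      intro s hs t ht hst heq
      have h1 := hσ.final ht
      rw [← heq] at h1
      have := hmin _ _ ((hσ.initial hs).join h1) (joinCurve_mapsTo (hi hσΓ hs) (hf hσΓ ht))
      linarith
    intro s hs t ht heq
    rcases lt_trichotomy s t with h | h | h
    · exact absurd heq (hne s hs t ht h)
    · exact h
    · exact absurd heq.symm (hne t ht s hs h)
  · intro s hs
    obtain ⟨τ, hτ, heq⟩ := hσΓ hs
    -- Replacing a part of σ by the corresponding part of c gives a competitor, which is not shorter
    -- than σ.
    refine ⟨τ, hτ, heq.symm, ?_, ?_⟩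
    · have h1 := hσ.final hs
      rw [← heq] at h1
      have := hmin _ _ ((hc.initial hτ).join h1) (joinCurve_mapsTo (hi hcΓ hτ) (hf hσΓ hs))
      linarith
    · have h1 := hc.final hτ
      rw [heq] at h1
      have := hmin _ _ ((hσ.initial hs).join h1) (joinCurve_mapsTo (hi hσΓ hs) (hf hcΓ hτ))
      linarith

variable [NormedSpace ℝ E]

theorem isUniform_of_exists_curve {G : Set E} {D : ℝ}
    (h : ∀ x ∈ G, ∀ y ∈ G, x ≠ y → ∃ c l, IsCurve c l x y ∧ MapsTo c (Icc 0 l) G ∧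
      l ≤ D * dist x y ∧ ∀ s ∈ Icc 0 l, min s (l - s) ≤ D * bdist G (c s)) : IsUniform D G := by
  intro x hx y hy hxy
  obtain ⟨c, l, hc, hcG, hl, hcig⟩ := h x hx y hy hxy
  obtain ⟨σ, m, hσ, hm0, hml, hinj, harc⟩ := hc.exists_arc hxy
  have hmem : ∀ {t : ℝ}, t ∈ Icc (0 : ℝ) 1 → m * t ∈ Icc 0 m := fun {t} ht =>
    ⟨mul_nonneg hm0.le ht.1, mul_le_of_le_one_right hm0.le ht.2⟩
  have hσG : MapsTo σ (Icc 0 m) G := fun s hs => by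
    obtain ⟨τ, hτ, heq, -⟩ := harc s hs
    exact heq ▸ hcG hτ
  have hrect := hσ.isRectCurve hσG
  refine ⟨fun t => σ (m * t), hrect.continuousOn, fun s hs t ht hst => ?_, hrect.mapsTo,
    hrect.source, hrect.target, ?_, fun t ht => ?_⟩
  · exact mul_left_cancel₀ hm0.ne' (hinj (hmem hs) (hmem ht) hst)
  · refine (hσ.eVariationOn_comp_mul_le le_rfl le_rfl).trans (ENNReal.ofReal_le_ofReal ?_)
    linarith
  · obtain ⟨τ, hτ, heq, h1, h2⟩ := harc _ (hmem ht)
    have h3 := hcig τ hτ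
    have e1 := hσ.eVariationOn_comp_mul_le (a := 0) (b := t) le_rfl ht.2
    have e2 := hσ.eVariationOn_comp_mul_le (a := t) (b := 1) ht.1 le_rfl
    simp only [heq]
    rcases min_le_iff.1 h3 with h4 | h4
    · refine (min_le_left _ _).trans (e1.trans (ENNReal.ofReal_le_ofReal ?_))
      linarith
    · refine (min_le_right _ _).trans (e2.trans (ENNReal.ofReal_le_ofReal ?_))
      linarith

end Arcs

/-! ### Cigar curves from plumpness and quasihyperbolic bounds -/

section CigarCurves

variable {E : Type u} [NormedAddCommGroup E] {G : Set E}

/-- Halving the scale until it is comparable to d_G(x) gives a chain of plump points. The pieces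
have lengths controlled by a geometric series, and each keeps a distance from the boundary
comparable to its scale. -/
theorem exists_john_curve {P Q : ℝ} (hP : 1 ≤ P) (hQ : 1 ≤ Q)
    (hplump : IsPlump P G) (hconn : ∀ p ∈ G, ∀ q ∈ G, ∀ m, dist p q ≤ 4 * P * m → m ≤ bdist G p →
      m ≤ bdist G q → ∃ c l, IsCurve c l p q ∧ MapsTo c (Icc 0 l) G ∧ l ≤ Q * bdist G p ∧
        ∀ t ∈ Icc 0 l, bdist G p ≤ Q * bdist G (c t))
    {x y : E} (hx : x ∈ G) (hy : y ∈ G) (n : ℕ) : ∀ ρ, 0 < ρ → bdist G x / 2 ≤ ρ →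
      ρ ≤ 2 ^ n * bdist G x → ρ ≤ dist x y → ∀ w ∈ G, dist x w ≤ ρ → ρ ≤ P * bdist G w →
      ∃ c l, IsCurve c l x w ∧ MapsTo c (Icc 0 l) G ∧ l ≤ 6 * Q * ρ ∧
        ∀ s ∈ Icc 0 l, s ≤ 12 * P * Q ^ 2 * bdist G (c s) := by
  have base : ∀ ρ, 0 < ρ → bdist G x / 2 ≤ ρ → ρ ≤ bdist G x → ∀ w ∈ G, dist x w ≤ ρ →
      ρ ≤ P * bdist G w → ∃ c l, IsCurve c l x w ∧ MapsTo c (Icc 0 l) G ∧ l ≤ 6 * Q * ρ ∧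
        ∀ s ∈ Icc 0 l, s ≤ 12 * P * Q ^ 2 * bdist G (c s) := by
    intro ρ hρ h1 h2 w hw hxw hρw
    obtain ⟨c, l, hc, hcG, hl, hfar⟩ := hconn x hx w hw (ρ / P) (by
      rw [mul_assoc, mul_div_cancel₀ _ (by positivity)]
      linarith) ((div_le_self hρ.le hP).trans h2) (by rwa [div_le_iff₀' (by positivity)])
    refine ⟨c, l, hc, hcG, by nlinarith, fun s hs => ?_⟩
    have h3 := hfar s hs
    have h4 : Q * bdist G x ≤ Q * (Q * bdist G (c s)) := by gcongr
    have h5 : 1 * (Q ^ 2 * bdist G (c s)) ≤ P * (Q ^ 2 * bdist G (c s)) := by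
      have := bdist_nonneg (G := G) (c s)
      gcongr
    have h6 : 0 ≤ P * (Q ^ 2 * bdist G (c s)) := by
      have := bdist_nonneg (G := G) (c s)
      positivity
    linarith [hs.2]
  induction n with
  | zero =>
    intro ρ hρ h1 h2 _ w hw hxw hρw
    exact base ρ hρ h1 (by simpa using h2) w hw hxw hρw
  | succ n ih =>
    intro ρ hρ h1 h2 h3 w hw hxw hρw
    rcases le_or_gt ρ (bdist G x) with h4 | h4
    · exact base ρ hρ h1 h4 w hw hxw hρw
    obtain ⟨v, hv, hxv, hρv⟩ := hplump x hx y hy (ρ / 2) (by positivity) (by linarith)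
    obtain ⟨c₁, l₁, hc₁, hcG₁, hl₁, hcig₁⟩ := ih (ρ / 2) (by positivity) (by linarith)
      (by rw [pow_succ] at h2; linarith) (by linarith) v hv hxv hρv
    obtain ⟨c₂, l₂, hc₂, hcG₂, hl₂, hfar₂⟩ := hconn v hv w hw (ρ / 2 / P) (by
      rw [mul_assoc, mul_div_cancel₀ _ (by positivity)]
      linarith [dist_triangle_left v w x]) (by rwa [div_le_iff₀' (by positivity)]) (by
      rw [div_le_iff₀' (by positivity)]
      linarith)
    have hdv : bdist G v ≤ 3 / 2 * ρ := by
      have := bdist_le_add (G := G) v x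
      rw [dist_comm] at this
      linarith
    have hl : l₁ + l₂ ≤ 6 * Q * ρ := by
      have h5 : Q * bdist G v ≤ Q * (3 / 2 * ρ) := by gcongr
      have h6 : 0 ≤ Q * ρ := by positivity
      linarith
    refine ⟨_, _, hc₁.join hc₂, joinCurve_mapsTo hcG₁ hcG₂, hl,
      joinCurve_forall (P := fun s z => s ≤ 12 * P * Q ^ 2 * bdist G z) hcig₁ fun s hs => ?_⟩
    have h7 := hfar₂ s hs
    calc
      l₁ + s ≤ 6 * Q * ρ := by linarith [hs.2]
      _ ≤ 6 * Q * (2 * (P * bdist G v)) := by gcongr; linarith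
      _ = 12 * P * Q * bdist G v := by ring
      _ ≤ 12 * P * Q * (Q * bdist G (c₂ s)) := by gcongr
      _ = _ := by ring

/-- If x or y is far from the boundary, the segment suffices. Otherwise curves from x and y lead to
plump points at scale |x - y|, which are then joined; the three lengths 6Q, 3Q, 6Q in units of |x -
y| give 15. -/
theorem exists_cigar_curve [NormedSpace ℝ E] {P Q : ℝ} (hG : IsProperDomain G) (hP : 1 ≤ P)
    (hQ : 1 ≤ Q)
    (hplump : IsPlump P G) (hconn : ∀ p ∈ G, ∀ q ∈ G, ∀ m, dist p q ≤ 4 * P * m → m ≤ bdist G p →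
      m ≤ bdist G q → ∃ c l, IsCurve c l p q ∧ MapsTo c (Icc 0 l) G ∧ l ≤ Q * bdist G p ∧
        ∀ t ∈ Icc 0 l, bdist G p ≤ Q * bdist G (c t))
    {x y : E} (hx : x ∈ G) (hy : y ∈ G) (hxy : x ≠ y) :
    ∃ c l, IsCurve c l x y ∧ MapsTo c (Icc 0 l) G ∧ l ≤ 15 * P * Q ^ 2 * dist x y ∧
      ∀ s ∈ Icc 0 l, min s (l - s) ≤ 15 * P * Q ^ 2 * bdist G (c s) := by
  have hρ : 0 < dist x y := dist_pos.2 hxy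
  have hPQ : 1 ≤ P * Q ^ 2 := one_le_mul_of_one_le_of_one_le hP (one_le_pow₀ hQ)
  have hseg : 2 * dist x y ≤ bdist G x ∨ 2 * dist x y ≤ bdist G y →
      ∃ c l, IsCurve c l x y ∧ MapsTo c (Icc 0 l) G ∧ l ≤ 15 * P * Q ^ 2 * dist x y ∧
        ∀ s ∈ Icc 0 l, min s (l - s) ≤ 15 * P * Q ^ 2 * bdist G (c s) := by
    intro hbig
    obtain ⟨c, hc, -⟩ := IsCurve.exists_segment x y
    have hd : ∀ s ∈ Icc 0 (dist x y), dist x (c s) ≤ dist x y ∧ dist y (c s) ≤ dist x y := by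
      intro s hs
      have h1 := hc.dist_le_sub le_rfl hs.1 hs.2
      have h2 := hc.dist_le_sub hs.1 hs.2 le_rfl
      rw [hc.source] at h1
      rw [hc.target, dist_comm] at h2
      constructor <;> linarith [hs.1, hs.2]
    have hfar : ∀ s ∈ Icc 0 (dist x y), dist x y ≤ bdist G (c s) := by
      intro s hs
      obtain ⟨h1, h2⟩ := hd s hs
      rcases hbig with h | h
      · linarith [bdist_le_add (G := G) x (c s)]
      · linarith [bdist_le_add (G := G) y (c s)]
    refine ⟨c, _, hc, fun s hs => ?_, by nlinarith, fun s hs => ?_⟩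
    · obtain ⟨h1, h2⟩ := hd s hs
      rcases hbig with h | h
      · refine hG.ball_subset hx ?_
        rw [mem_ball, dist_comm]
        linarith
      · refine hG.ball_subset hy ?_
        rw [mem_ball, dist_comm]
        linarith
    · refine (min_le_left _ _).trans (hs.2.trans ((hfar s hs).trans ?_))
      have := bdist_nonneg (G := G) (c s)
      nlinarith
  rcases le_or_gt (2 * dist x y) (bdist G x) with hx2 | hx2
  · exact hseg (Or.inl hx2)
  rcases le_or_gt (2 * dist x y) (bdist G y) with hy2 | hy2
  · exact hseg (Or.inr hy2)
  have htail : ∀ x ∈ G, ∀ y ∈ G, 0 < dist x y → bdist G x < 2 * dist x y →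
      ∃ w ∈ G, dist x w ≤ dist x y ∧ dist x y ≤ P * bdist G w ∧
      ∃ c l, IsCurve c l x w ∧ MapsTo c (Icc 0 l) G ∧ l ≤ 6 * Q * dist x y ∧
        ∀ s ∈ Icc 0 l, s ≤ 12 * P * Q ^ 2 * bdist G (c s) := by
    intro x hx y hy hρ hx2
    obtain ⟨w, hw, hxw, hρw⟩ := hplump x hx y hy _ hρ le_rfl
    obtain ⟨n, hn⟩ := pow_unbounded_of_one_lt (dist x y / bdist G x) one_lt_two
    rw [div_lt_iff₀ (hG.bdist_pos hx)] at hn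
    exact ⟨w, hw, hxw, hρw, exists_john_curve hP hQ hplump hconn hx hy n _ hρ (by linarith) hn.le
      le_rfl w hw hxw hρw⟩
  obtain ⟨w, hw, hxw, hρw, c₁, l₁, hc₁, hcG₁, hl₁, hcig₁⟩ := htail x hx y hy hρ hx2
  obtain ⟨v, hv, hyv, hρv, c₃, l₃, hc₃, hcG₃, hl₃, hcig₃⟩ := htail y hy x hx
    (by rwa [dist_comm]) (by rwa [dist_comm y x])
  rw [dist_comm y x] at hyv hρv hl₃
  obtain ⟨c₂, l₂, hc₂, hcG₂, hl₂, hfar₂⟩ := hconn w hw v hv (dist x y / P) (by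
    rw [mul_assoc, mul_div_cancel₀ _ (by positivity)]
    linarith [dist_triangle_left w v x, dist_triangle x y v])
    (by rwa [div_le_iff₀' (by positivity)]) (by rwa [div_le_iff₀' (by positivity)])
  have hdw : bdist G w ≤ 3 * dist x y := by
    have := bdist_le_add (G := G) w x
    rw [dist_comm] at this
    linarith
  have hl : l₁ + l₂ + l₃ ≤ 15 * Q * dist x y := by
    have h5 : Q * bdist G w ≤ Q * (3 * dist x y) := by gcongr
    linarith
  have hcig' : ∀ {z : E} {s : ℝ}, s ≤ 12 * P * Q ^ 2 * bdist G z →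
      s ≤ 15 * P * Q ^ 2 * bdist G z := fun {z s} h => by
    have : 0 ≤ P * Q ^ 2 * bdist G z := mul_nonneg (by positivity) (bdist_nonneg z)
    linarith
  refine ⟨_, _, (hc₁.join hc₂).join hc₃.reverse, joinCurve_mapsTo (joinCurve_mapsTo hcG₁ hcG₂)
    (fun s hs => hcG₃ (IsCurve.sub_mem hs)), hl.trans ?_,
    joinCurve_forall (P := fun s z => min s (l₁ + l₂ + l₃ - s) ≤ 15 * P * Q ^ 2 * bdist G z)
      (joinCurve_forall (P := fun s z => min s (l₁ + l₂ + l₃ - s) ≤ 15 * P * Q ^ 2 * bdist G z)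
        (fun s hs => (min_le_left _ _).trans (hcig' (hcig₁ s hs))) fun s hs => ?_)
      fun s hs => ?_⟩
  · have : Q ≤ P * Q ^ 2 := by nlinarith
    have h2 : Q * dist x y ≤ P * Q ^ 2 * dist x y := by gcongr
    linarith
  · have h6 := hfar₂ s hs
    refine (min_le_left _ _).trans ?_
    have := hc₃.nonneg
    calc
      l₁ + s ≤ 15 * Q * dist x y := by linarith [hs.2]
      _ ≤ 15 * Q * (P * bdist G w) := by gcongr
      _ ≤ 15 * Q * (P * (Q * bdist G (c₂ s))) := by gcongr
      _ = _ := by ring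
  · refine (min_le_right _ _).trans (le_trans (le_of_eq ?_)
      (hcig' (hcig₃ (l₃ - s) (IsCurve.sub_mem hs))))
    ring

end CigarCurves

/-! ### Uniformity of the image -/

section Uniform

theorem exists_isUniform (η : ℝ≥0 ≃ₜ ℝ≥0) {c M C : ℝ} (hc : 1 ≤ c) (hM : 1 ≤ M) (hC : 0 ≤ C) :
    ∃ c' : ℝ, 1 ≤ c' ∧
      ∀ {E : Type u} [NormedAddCommGroup E] [NormedSpace ℝ E]
        {E' : Type v} [NormedAddCommGroup E'] [NormedSpace ℝ E'] {G : Set E} {G' : Set E'}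
        {f : G ≃ₜ G'}, 2 ≤ Module.rank ℝ E' → IsProperDomain G → IsProperDomain G' →
        IsCQH M C f → HasQMExtension η f → IsUniform c G → IsUniform c' G' := by
  obtain ⟨P, hP, hplump⟩ := exists_isPlump.{u, v} η hc
  obtain ⟨K, hK, hbound⟩ := exists_qhEDist_bound.{u, v} η (t := 4 * P) hc hM hC (by positivity)
  have hQ : 1 ≤ Real.exp (K + 1) := Real.one_le_exp (by positivity)
  have hPQ : 1 ≤ P * Real.exp (K + 1) ^ 2 :=
    one_le_mul_of_one_le_of_one_le hP (one_le_pow₀ hQ)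
  refine ⟨15 * P * Real.exp (K + 1) ^ 2, by linarith, ?_⟩
  intro E _ _ E' _ _ G G' f hE' hG hG' hf hext hunif
  refine isUniform_of_exists_curve fun x hx y hy hxy =>
    exists_cigar_curve hG' hP hQ (hplump hG hG' hext (hunif.isBoundaryPlump hc))
      (fun p hp q hq m h h1 h2 => ?_) hx hy hxy
  have hle := hbound hE' hG hG' hf hext hunif p hp q hq
    (hG'.relDist_le hp hq h (by positivity) h1 h2)
  exact exists_isCurve_of_qhEDist_lt hG' (hle.trans_lt
    ((ENNReal.ofReal_lt_ofReal_iff (by linarith)).2 (lt_add_one K)))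

end Uniform

end RelQM

theorem theorem1p4 :
    (∀ (ψ : ℝ≥0 → ℝ≥0) (M C : ℝ) (η : ℝ≥0 ≃ₜ ℝ≥0), Monotone ψ → 1 ≤ M → 0 ≤ C →
      ∃ ψ' : ℝ≥0 → ℝ≥0, Monotone ψ' ∧
        ∀ (E : Type u) [NormedAddCommGroup E] [NormedSpace ℝ E] [CompleteSpace E]
          (E' : Type v) [NormedAddCommGroup E'] [NormedSpace ℝ E'] [CompleteSpace E'],
          2 ≤ Module.rank ℝ E → 2 ≤ Module.rank ℝ E' →
          ∀ (G : Set E) (G' : Set E'), RelQM.IsProperDomain G → RelQM.IsProperDomain G' →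
          ∀ f : G ≃ₜ G', RelQM.IsCQH M C f → RelQM.HasQMExtension η f →
            RelQM.IsNatural ψ G → RelQM.IsNatural ψ' G') ∧
    (∀ (c M C : ℝ) (η : ℝ≥0 ≃ₜ ℝ≥0), 1 ≤ c → 1 ≤ M → 0 ≤ C →
      ∃ c' : ℝ, 1 ≤ c' ∧
        ∀ (E : Type u) [NormedAddCommGroup E] [NormedSpace ℝ E] [CompleteSpace E]
          (E' : Type v) [NormedAddCommGroup E'] [NormedSpace ℝ E'] [CompleteSpace E'],
          2 ≤ Module.rank ℝ E → 2 ≤ Module.rank ℝ E' →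
          ∀ (G : Set E) (G' : Set E'), RelQM.IsProperDomain G → RelQM.IsProperDomain G' →
          ∀ f : G ≃ₜ G', RelQM.IsCQH M C f → RelQM.HasQMExtension η f →
            RelQM.IsUniform c G → RelQM.IsUniform c' G') := by
  refine ⟨fun ψ M C η hψ hM hC => ?_, fun c M C η hc hM hC => ?_⟩
  · obtain ⟨ψ', hψ', h⟩ := RelQM.exists_isNatural.{u, v} ψ η hψ hM hC
    exact ⟨ψ', hψ', fun E _ _ _ E' _ _ _ _ hE' G G' hG hG' f hf hext hnat =>
      h hE' hG hG' hf hext hnat⟩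
  · obtain ⟨c', hc', h⟩ := RelQM.exists_isUniform.{u, v} η hc hM hC
    exact ⟨c', hc', fun E _ _ _ E' _ _ _ _ hE' G G' hG hG' f hf hext hunif =>
      h hE' hG hG' hf hext hunif⟩
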